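/- Let $(\Omega,\mathscr G,P)$ be a probability space, $L^0$ the ring of (classes of) real-valued and $\bar L^0$ the set of (classes of) $[-\infty,\infty]$-valued $\mathscr G$-measurable random variables, with the almost sure order, and $L^0_{++}=\{m\in L^0: m>0\}$. Equip $L^0$ with the topology in which the balls $\{n:|m-n|\le\varepsilon\}$, $\varepsilon\in L^0_{++}$, form a neighbourhood base of $m$. In $\bar L^0$ use the conventions $\infty-\infty=-\infty$ and $0\cdot(\pm\infty)=0$. Let $\mathcal X$ be a conditional locally convex topological $L^0$-module, i.e. a topological $L^0$-module such that (1) for every countable measurable partition $(A_i)$ of $\Omega$ and every sequence $(X_i)$ in $\mathcal X$ there is exactly one $Y=\sum 1_{A_i}X_i\in\mathcal X$ with $1_{A_i}Y=1_{A_i}X_i$ for all $i$; (2) $0$ has a neighbourhood base of $L^0$-convex, $L^0$-absorbent, $L^0$-balanced and $\sigma$-stable sets; (3) if the $U_i$ are neighbourhoods of $0$ and $(A_i)$ is such a partition, then $\sum 1_{A_i}U_i$ is a neighbourhood of $0$. Here a set $\mathcal C$ is $\sigma$-stable if $\sum 1_{A_i}X_i\in\mathcal C$ for all such partitions and all $X_i\in\mathcal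 C$, and $L^0$-convex if $\lambda X+(1-\lambda)Y\in\mathcal C$ for $X,Y\in\mathcal C$ and $\lambda\in L^0$, $0\le\lambda\le1$. Let $\mathcal X^*$ be the module of continuous $L^0$-linear maps $\mathcal X\to L^0$, with the coarsest topology making all evaluations $X^*\mapsto\langle X^*,X\rangle=X^*(X)$ continuous. Let $\mathcal K\subseteq\mathcal X$ be a closed $L^0$-convex cone containing $0$ and $\mathcal K^\circ=\{X^*\in\mathcal X^*:\langle X^*,X\rangle\ge0\text{ for all }X\in\mathcal K\}$. Consider the following properties of a function $\pi:\mathcal K^\circ\to\bar L^0$: it is local, $\pi(1_AX^*+1_{A^c}Y^*)=1_A\pi(X^*)+1_{A^c}\pi(Y^*)$ for $A\in\mathscr G$; (a) it is positively homogeneous, $\pi(\lambda X^*)=\lambda\pi(X^*)$ for $\lambda\in L^0_{++}$, and concave, $\pi(\lambda X^*+(1-\lambda)Y^*)\ge\lambda\pi(X^*)+(1-\lambda)\pi(Y^*)$ for $\lambda\in L^0$, $0\le\lambda\le1$; (b) it is maximal invariant: if $\pi(X^*)=\infty$ for some $X^*\in\mathcal K^\circ$, then $\pi(Y^*)=\infty$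 for all $Y^*\in\mathcal K^\circ$; (c) it is upper semicontinuous: $\{X^*\in\mathcal K^\circ:\pi(X^*)\ge m\}$ is closed for all $m\in\bar L^0$. Let $\mathcal C\subseteq\mathcal X$ be closed, $L^0$-convex, monotone ($\mathcal C+\mathcal K=\mathcal C$) and $\sigma$-stable. Then the function $$\pi(X^*)=\operatorname*{ess\,inf}_{X\in\mathcal C}\langle X^*,X\rangle,\qquad X^*\in\mathcal K^\circ,$$ is well defined (the essential infimum being the greatest lower bound in $\bar L^0$, $=\infty$ if $\mathcal C=\emptyset$), is local, satisfies (a)--(c), and $$X\in\mathcal C\iff\langle X^*,X\rangle\ge\pi(X^*)\ \text{ for all }X^*\in\mathcal K^\circ.\qquad(\ast)$$ If $\mathcal C\ne\emptyset$, then $\pi(0)=0$, and $\pi$ is the unique local function on $\mathcal K^\circ$ with (a)--(c), $(\ast)$ and value $0$ at $0$; the normalisation at $0$ may be dropped if there is no $A\in\mathscr G$ with $P[A]>0$ and $1_A\mathcal C=1_A\mathcal X$. If $\mathcal C=\emptyset$, then $\pi\equiv\infty$ is the only local function with (a)--(c) that takes the value $\infty$ (almost surely) at some point of $\mathcal K^\circ$.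 -/

import Mathlib

open MeasureTheory Filter Topology

namespace CondModule

noncomputable section

variable {Ω : Type*} [MeasurableSpace Ω]

/-- `L⁰`: classes of real random variables modulo almost sure equality. -/
abbrev L0 (P : Measure Ω) := Ω →ₘ[P] ℝ

/-- Classes of random variables with values in `[-∞, ∞]`, ordered by the almost sure order. -/
abbrev ExtL0 (P : Measure Ω) := Ω →ₘ[P] EReal

variable {P : Measure Ω}

instance instCommRingL0 : CommRing (L0 P) :=
  { (AEEqFun.instAddCommGroup : AddCommGroup (L0 P)),
    (AEEqFun.instCommMonoid : CommMonoid (L0 P)) with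
    left_distrib := by
      intro a b c
      apply AEEqFun.ext
      filter_upwards [AEEqFun.coeFn_mul a (b + c), AEEqFun.coeFn_add b c,
        AEEqFun.coeFn_add (a * b) (a * c), AEEqFun.coeFn_mul a b, AEEqFun.coeFn_mul a c]
        with ω h1 h2 h3 h4 h5
      simp only [h1, h2, h3, h4, h5, Pi.mul_apply, Pi.add_apply]
      ring
    right_distrib := by
      intro a b c
      apply AEEqFun.ext
      filter_upwards [AEEqFun.coeFn_mul (a + b) c, AEEqFun.coeFn_add a b,
        AEEqFun.coeFn_add (a * c) (b * c), AEEqFun.coeFn_mul a c, AEEqFun.coeFn_mul b c]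
        with ω h1 h2 h3 h4 h5
      simp only [h1, h2, h3, h4, h5, Pi.mul_apply, Pi.add_apply]
      ring
    zero_mul := by
      intro a
      apply AEEqFun.ext
      filter_upwards [AEEqFun.coeFn_mul 0 a,
        (AEEqFun.coeFn_zero : ⇑(0 : L0 P) =ᵐ[P] 0)] with ω h1 h2
      simp [h1, h2]
    mul_zero := by
      intro a
      apply AEEqFun.ext
      filter_upwards [AEEqFun.coeFn_mul a 0,
        (AEEqFun.coeFn_zero : ⇑(0 : L0 P) =ᵐ[P] 0)] with ω h1 h2
      simp [h1, h2] }

/-- `L⁰₊₊`: the almost surely strictly positive elements of `L⁰`. -/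
def StrictPos (m : L0 P) : Prop := ∀ᵐ ω ∂P, 0 < m ω

/-- The ball `{n : |n| ≤ ε}` around `0` in `L⁰`. -/
def ball0 (ε : L0 P) : Set (L0 P) := {n | |n| ≤ ε}

theorem mem_ball0 {ε n : L0 P} : n ∈ ball0 ε ↔ ∀ᵐ ω ∂P, |n ω| ≤ ε ω := by
  change |n| ≤ ε ↔ _
  rw [← AEEqFun.coeFn_le]
  constructor
  · intro h
    filter_upwards [h, AEEqFun.coeFn_abs n] with ω h1 h2
    rwa [← h2]
  · intro h
    filter_upwards [h, AEEqFun.coeFn_abs n] with ω h1 h2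
    rwa [h2]

/-- Auxiliary construction of a positive element out of a positive continuous expression. -/
theorem exists_strictPos (x : L0 P) {ε : L0 P} (hε : StrictPos ε)
    (g : ℝ → ℝ → ℝ) (hg : Continuous (Function.uncurry g))
    (hpos : ∀ a b, 0 < b → 0 < g a b) :
    ∃ δ : L0 P, StrictPos δ ∧ ∀ᵐ ω ∂P, δ ω = g (x ω) (ε ω) := by
  refine ⟨AEEqFun.comp₂ g hg x ε, ?_, AEEqFun.coeFn_comp₂ g hg x ε⟩
  filter_upwards [hε, AEEqFun.coeFn_comp₂ g hg x ε] with ω h1 h2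
  rw [h2]
  exact hpos _ _ h1

theorem exists_ball_mul (x : L0 P) {ε : L0 P} (hε : StrictPos ε) :
    ∃ δ : L0 P, StrictPos δ ∧ ∀ n ∈ ball0 δ, x * n ∈ ball0 ε := by
  obtain ⟨δ, hδ, he⟩ := exists_strictPos x hε (fun a b => b * (1 + |a|)⁻¹)
    (by
      have h : ∀ p : ℝ × ℝ, (1 + |p.1|) ≠ 0 := fun p => by positivity
      exact continuous_snd.mul
        ((continuous_const.add continuous_fst.abs).inv₀ h))
    (fun a b hb => by positivity)
  refine ⟨δ, hδ, fun n hn => ?_⟩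
  rw [mem_ball0] at hn ⊢
  filter_upwards [hn, he, hε, AEEqFun.coeFn_mul x n] with ω h1 h2 h3 h4
  rw [h4, Pi.mul_apply, abs_mul]
  rw [h2] at h1
  calc |x ω| * |n ω| ≤ (1 + |x ω|) * (ε ω * (1 + |x ω|)⁻¹) := by
        apply mul_le_mul (by linarith) h1 (abs_nonneg _) (by positivity)
    _ = ε ω := by
        have : (1 + |x ω|) ≠ 0 := by positivity
        field_simp

/-- The filter basis of `0` in `L⁰` formed by the balls with random radius in `L⁰₊₊`. -/
@[reducible] def l0Basis : RingFilterBasis (L0 P) where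
  sets := {U | ∃ ε : L0 P, StrictPos ε ∧ U = ball0 ε}
  nonempty := by
    refine ⟨_, 1, ?_, rfl⟩
    filter_upwards [(AEEqFun.coeFn_one : ⇑(1 : L0 P) =ᵐ[P] 1)] with ω h
    simp [h]
  inter_sets := by
    rintro _ _ ⟨ε, hε, rfl⟩ ⟨η, hη, rfl⟩
    refine ⟨_, ⟨ε ⊓ η, ?_, rfl⟩, fun n hn =>
      ⟨le_trans (show |n| ≤ ε ⊓ η from hn) inf_le_left,
        le_trans (show |n| ≤ ε ⊓ η from hn) inf_le_right⟩⟩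
    filter_upwards [hε, hη, AEEqFun.coeFn_inf ε η] with ω h1 h2 h3
    rw [h3]
    exact lt_inf_iff.2 ⟨h1, h2⟩
  zero' := by
    rintro _ ⟨ε, hε, rfl⟩
    rw [mem_ball0]
    filter_upwards [hε, (AEEqFun.coeFn_zero : ⇑(0 : L0 P) =ᵐ[P] 0)] with ω h1 h2
    rw [h2]
    simpa using h1.le
  add' := by
    rintro _ ⟨ε, hε, rfl⟩
    obtain ⟨δ, hδ, he⟩ := exists_strictPos 0 hε (fun _ b => b / 2)
      (by exact continuous_snd.div_const 2) (fun a b hb => by positivity)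
    refine ⟨_, ⟨δ, hδ, rfl⟩, ?_⟩
    rintro _ ⟨a, ha, b, hb, rfl⟩
    rw [mem_ball0] at ha hb ⊢
    filter_upwards [ha, hb, he, AEEqFun.coeFn_add a b] with ω h1 h2 h3 h4
    simp only [h4, Pi.add_apply]
    calc |a ω + b ω| ≤ |a ω| + |b ω| := abs_add_le _ _
      _ ≤ ε ω := by rw [h3] at h1 h2; linarith
  neg' := by
    rintro _ ⟨ε, hε, rfl⟩
    refine ⟨_, ⟨ε, hε, rfl⟩, fun n hn => ?_⟩
    rw [Set.mem_preimage, mem_ball0]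
    rw [mem_ball0] at hn
    filter_upwards [hn, AEEqFun.coeFn_neg n] with ω h1 h2
    rw [h2]
    simpa using h1
  conj' := by
    rintro x _ ⟨ε, hε, rfl⟩
    refine ⟨_, ⟨ε, hε, rfl⟩, fun n hn => ?_⟩
    simpa using hn
  mul' := by
    rintro _ ⟨ε, hε, rfl⟩
    obtain ⟨δ, hδ, he⟩ := exists_strictPos 0 hε (fun _ b => min 1 b)
      (by exact continuous_const.min continuous_snd) (fun a b hb => lt_min one_pos hb)
    refine ⟨_, ⟨δ, hδ, rfl⟩, ?_⟩
    rintro _ ⟨a, ha, b, hb, rfl⟩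
    rw [mem_ball0] at ha hb ⊢
    filter_upwards [ha, hb, he, AEEqFun.coeFn_mul a b] with ω h1 h2 h3 h4
    simp only [h4, Pi.mul_apply]
    rw [h3] at h1 h2
    rw [abs_mul]
    calc |a ω| * |b ω| ≤ 1 * |b ω| :=
          mul_le_mul_of_nonneg_right (h1.trans (min_le_left _ _)) (abs_nonneg _)
      _ ≤ ε ω := by rw [one_mul]; exact h2.trans (min_le_right _ _)
  mul_left' := by
    rintro x _ ⟨ε, hε, rfl⟩
    obtain ⟨δ, hδ, h⟩ := exists_ball_mul x hε
    exact ⟨_, ⟨δ, hδ, rfl⟩, fun n hn => h n hn⟩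
  mul_right' := by
    rintro x _ ⟨ε, hε, rfl⟩
    obtain ⟨δ, hδ, h⟩ := exists_ball_mul x hε
    exact ⟨_, ⟨δ, hδ, rfl⟩, fun n hn => by
      rw [Set.mem_preimage, mul_comm]
      exact h n hn⟩

/-- The topology on `L⁰` in which the balls `{n : |m - n| ≤ ε}`, `ε ∈ L⁰₊₊`, form a
neighbourhood base of `m`. -/
instance instTopologicalSpaceL0 : TopologicalSpace (L0 P) := l0Basis.topology

instance instIsTopologicalRingL0 : IsTopologicalRing (L0 P) := l0Basis.isTopologicalRing

theorem nhds_zero_hasBasis_L0 :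
    (𝓝 (0 : L0 P)).HasBasis StrictPos ball0 := by
  have h := (l0Basis (P := P)).toAddGroupFilterBasis.nhds_zero_hasBasis
  refine ⟨fun t => (h.mem_iff).trans ?_⟩
  constructor
  · rintro ⟨_, ⟨ε, hε, rfl⟩, ht⟩
    exact ⟨ε, hε, ht⟩
  · rintro ⟨ε, hε, ht⟩
    exact ⟨_, ⟨ε, hε, rfl⟩, ht⟩

/-- The inclusion of `L⁰` into the extended random variables. -/
def toExt (m : L0 P) : ExtL0 P :=
  AEEqFun.comp (fun r : ℝ => (r : EReal)) continuous_coe_real_ereal m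

/-- The indicator `1_A` of an event, as an element of `L⁰`. -/
def ind (P : Measure Ω) (A : Set Ω) (hA : MeasurableSet A) : L0 P :=
  AEEqFun.mk (A.indicator fun _ => (1 : ℝ))
    (stronglyMeasurable_const.indicator hA).aestronglyMeasurable

/-- Countable measurable partitions of `Ω` (members may be empty). -/
structure EventPartition (Ω : Type*) [MeasurableSpace Ω] where
  set : ℕ → Set Ω
  measurable : ∀ i, MeasurableSet (set i)
  disjoint : Pairwise fun i j => Disjoint (set i) (set j)
  cover : ⋃ i, set i = Set.univ

variable {E : Type*} [AddCommGroup E] [Module (L0 P) E]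

variable (P) in
/-- `Y = ∑ 1_{A_i} X_i`. -/
def IsConcat (A : EventPartition Ω) (X : ℕ → E) (Y : E) : Prop :=
  ∀ i, ind P (A.set i) (A.measurable i) • Y = ind P (A.set i) (A.measurable i) • X i

variable (P) in
/-- `C` contains every `∑ 1_{A_i} X_i` with `X_i ∈ C`. -/
def SigmaStable (C : Set E) : Prop :=
  ∀ (A : EventPartition Ω) (X : ℕ → E), (∀ i, X i ∈ C) → ∀ Y, IsConcat P A X Y → Y ∈ C

variable (P) in
def L0Convex (C : Set E) : Prop :=
  ∀ l : L0 P, 0 ≤ l → l ≤ 1 → ∀ X ∈ C, ∀ Y ∈ C, l • X + (1 - l) • Y ∈ C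

variable (P) in
def L0Absorbent (U : Set E) : Prop :=
  ∀ X : E, ∃ l : L0 P, StrictPos l ∧ ∃ u ∈ U, X = l • u

variable (P) in
def L0Balanced (U : Set E) : Prop :=
  ∀ l : L0 P, |l| ≤ 1 → ∀ X ∈ U, l • X ∈ U

variable (P) in
/-- `∑ 1_{A_i} U_i` for a sequence of sets. -/
def concatSets (A : EventPartition Ω) (U : ℕ → Set E) : Set E :=
  {Y | ∃ X : ℕ → E, (∀ i, X i ∈ U i) ∧ IsConcat P A X Y}

variable (P E) in
/-- A topological `L⁰`-module is a conditional locally convex module if every countable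
concatenation `∑ 1_{A_i} X_i` is a well-defined element, the topology has a base of neighbourhoods
of `0` made of `L⁰`-convex, `L⁰`-absorbent, `L⁰`-balanced and `σ`-stable sets, and the collection
of all neighbourhoods of `0` is stable under countable concatenation. -/
structure CondLocallyConvex [TopologicalSpace E] [IsTopologicalAddGroup E]
    [ContinuousSMul (L0 P) E] : Prop where
  existsUnique_concat : ∀ (A : EventPartition Ω) (X : ℕ → E), ∃! Y, IsConcat P A X Y
  exists_nhds : ∀ U ∈ 𝓝 (0 : E), ∃ V ∈ 𝓝 (0 : E), V ⊆ U ∧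
    L0Convex P V ∧ L0Absorbent P V ∧ L0Balanced P V ∧ SigmaStable P V
  concat_nhds : ∀ (A : EventPartition Ω) (U : ℕ → Set E), (∀ i, U i ∈ 𝓝 (0 : E)) →
    concatSets P A U ∈ 𝓝 (0 : E)

variable (P) in
/-- `L⁰`-convex cones containing `0`. -/
structure IsL0ConvexCone (K : Set E) : Prop where
  zero_mem : (0 : E) ∈ K
  convex : L0Convex P K
  smul_mem : ∀ l : L0 P, StrictPos l → ∀ X ∈ K, l • X ∈ K

/-- `C + K = C`. -/
def MonotoneSet (K C : Set E) : Prop := Set.image2 (fun X Y => X + Y) C K = C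

variable (P) in
/-- There is no event `A` of positive probability with `1_A C = 1_A E`. -/
def NowhereFull (C : Set E) : Prop :=
  ∀ (A : Set Ω) (hA : MeasurableSet A), 0 < P A →
    ∃ X : E, ∀ Y ∈ C, ind P A hA • Y ≠ ind P A hA • X

variable [TopologicalSpace E]

variable (P) in
/-- The polar cone `K°` in the `L⁰`-dual. `WeakDual (L0 P) E` is the `L⁰`-module of continuous
`L⁰`-linear maps `E → L⁰`, with the coarsest topology making all evaluations continuous. -/
def polarCone (K : Set E) : Set (WeakDual (L0 P) E) := {f | ∀ X ∈ K, 0 ≤ f X}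

/-- Local functions on `S`: `π (1_A f + 1_{Aᶜ} g) = 1_A π f + 1_{Aᶜ} π g`. -/
def LocalOn (S : Set (WeakDual (L0 P) E)) (p : WeakDual (L0 P) E → ExtL0 P) : Prop :=
  ∀ (A : Set Ω) (hA : MeasurableSet A), ∀ f ∈ S, ∀ g ∈ S,
    ∀ᵐ ω ∂P, (ω ∈ A → p (ind P A hA • f + ind P Aᶜ hA.compl • g) ω = p f ω) ∧
      (ω ∉ A → p (ind P A hA • f + ind P Aᶜ hA.compl • g) ω = p g ω)

def PosHomogeneousOn (S : Set (WeakDual (L0 P) E)) (p : WeakDual (L0 P) E → ExtL0 P) : Prop :=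
  ∀ l : L0 P, StrictPos l → ∀ f ∈ S, ∀ᵐ ω ∂P, p (l • f) ω = (l ω : EReal) * p f ω

/-- `L⁰`-concavity, with the conventions `∞ - ∞ = -∞` and `0 · (±∞) = 0` of `EReal`. -/
def L0ConcaveOn (S : Set (WeakDual (L0 P) E)) (p : WeakDual (L0 P) E → ExtL0 P) : Prop :=
  ∀ l : L0 P, 0 ≤ l → l ≤ 1 → ∀ f ∈ S, ∀ g ∈ S,
    ∀ᵐ ω ∂P, (l ω : EReal) * p f ω + ((1 - l ω : ℝ) : EReal) * p g ω ≤
      p (l • f + (1 - l) • g) ω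

def MaximalInvariantOn (S : Set (WeakDual (L0 P) E)) (p : WeakDual (L0 P) E → ExtL0 P) : Prop :=
  (∃ f ∈ S, ∀ᵐ ω ∂P, p f ω = ⊤) → ∀ g ∈ S, ∀ᵐ ω ∂P, p g ω = ⊤

/-- All upper level sets are closed in `S`, for the weak topology. -/
def UpperSemicontOn (S : Set (WeakDual (L0 P) E)) (p : WeakDual (L0 P) E → ExtL0 P) : Prop :=
  ∀ m : ExtL0 P, IsClosed {f : S | m ≤ p f}

/-- The properties required of `π` on the polar cone. -/
structure IsPenaltyOn (S : Set (WeakDual (L0 P) E)) (p : WeakDual (L0 P) E → ExtL0 P) :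
    Prop where
  isLocal : LocalOn S p
  posHomogeneous : PosHomogeneousOn S p
  concave : L0ConcaveOn S p
  maximalInvariant : MaximalInvariantOn S p
  upperSemicont : UpperSemicontOn S p

/-- `X ∈ C` if and only if `⟨f, X⟩ ≥ π f` for all `f ∈ S`. -/
def Represents (S : Set (WeakDual (L0 P) E)) (p : WeakDual (L0 P) E → ExtL0 P) (C : Set E) :
    Prop :=
  ∀ X : E, X ∈ C ↔ ∀ f ∈ S, p f ≤ toExt (f X)

end

end CondModule

open MeasureTheory Filter Topology

namespace CondModule

noncomputable section

variable {Ω : Type*} [MeasurableSpace Ω] {P : Measure Ω}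

section

/-! ### Pointwise calculus in `L⁰` -/

/-! The support function is an essential infimum. It exists because, over a finite measure, it is
attained along a countable subfamily (`exists_seq_iInf_le`); locality, homogeneity, concavity,
maximal invariance and semicontinuity are then checked ω by ω or read off the evaluations at points
of `C`.

The representation is conditional separation. If X lies outside `C`, a `σ`-stable neighbourhood of X
misses `C`, and an exhaustion argument gives an event A of positive probability on every non-null
part of which they remain apart (`exists_event_disjoint`). The gauge of an `L⁰`-convex set and the
conditional Hahn-Banach theorem give a continuous form f whose values on `C` exceed f(X) strictly on
A (`exists_weakDual_separation`). Set to 0 off A, this form lies in the polar cone because `C` is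
monotone, and it violates the inequality defining the representation at X (`IsSupport.represents`).

For uniqueness, let p be the support function and q another penalty representing `C`; q ≤ p is
immediate. Suppose q(f₀) < r < s < p(f₀) on a non-null event. Semicontinuity and locality keep q
below r, on some event A, throughout a weak neighbourhood of f₀, which involves only finitely many
points of `E`. So (f₀, s) can be separated from the hypograph of q inside a finite power of `L⁰`,
where boxes serve as neighbourhoods and every linear form is evaluation at some X in `E` plus a
multiple of the level. The hypograph is a cone, so on A this gives ρ ≥ 0 with ρ q(f) ≤ f(X) wherever
q(f) is finite, and f₀(X) < ρ s (`exists_point_separation`). For c₀ in `C`, the points (c₀ + nX)/(1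
+ nρ) on A, c₀ off A, then satisfy all inequalities for q and lie in `C`; testing f₀ > s(f₀) on them
and letting n → ∞ contradicts f₀(X) < ρ s. The case ρ = 0 needs no separate treatment.

The normalisation is used to have (0, 0) in the hypograph. Homogeneity leaves only the values 0 and
-∞ at 0, and where q(0) = -∞ semicontinuity forces q = -∞ everywhere, so `C` is full there
(`map_zero_of_nowhereFull`). -/

theorem le_iff_ae {β : Type*} [TopologicalSpace β] [Preorder β] {a b : Ω →ₘ[P] β} :
    a ≤ b ↔ ∀ᵐ ω ∂P, a ω ≤ b ω :=
  AEEqFun.coeFn_le.symm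

theorem ae_add (a b : L0 P) : ∀ᵐ ω ∂P, (a + b) ω = a ω + b ω := AEEqFun.coeFn_add a b

theorem ae_mul (a b : L0 P) : ∀ᵐ ω ∂P, (a * b) ω = a ω * b ω := AEEqFun.coeFn_mul a b

theorem ae_sub (a b : L0 P) : ∀ᵐ ω ∂P, (a - b) ω = a ω - b ω := AEEqFun.coeFn_sub a b

theorem ae_zero : ∀ᵐ ω ∂P, (0 : L0 P) ω = 0 := AEEqFun.coeFn_zero

theorem ae_one : ∀ᵐ ω ∂P, (1 : L0 P) ω = 1 := AEEqFun.coeFn_one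

theorem ae_toExt (a : L0 P) : ∀ᵐ ω ∂P, toExt a ω = (a ω : EReal) := AEEqFun.coeFn_comp _ _ a

theorem ae_ind (A : Set Ω) (hA : MeasurableSet A) :
    ∀ᵐ ω ∂P, (ω ∈ A → ind P A hA ω = 1) ∧ (ω ∉ A → ind P A hA ω = 0) := by
  have h : ∀ᵐ ω ∂P, ind P A hA ω = A.indicator (fun _ => (1 : ℝ)) ω := AEEqFun.coeFn_mk _ _
  filter_upwards [h] with ω h
  simp +contextual [h]

/-- The class of a measurable function. -/
def ofMeas (P : Measure Ω) (g : Ω → ℝ) (hg : Measurable g) : L0 P :=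
  AEEqFun.mk g hg.aestronglyMeasurable

theorem ae_ofMeas (g : Ω → ℝ) (hg : Measurable g) : ∀ᵐ ω ∂P, ofMeas P g hg ω = g ω :=
  AEEqFun.coeFn_mk _ _

/-- The class of a measurable extended real function. -/
def ofMeasExt (P : Measure Ω) (g : Ω → EReal) (hg : Measurable g) : ExtL0 P :=
  AEEqFun.mk g hg.aestronglyMeasurable

theorem ae_ofMeasExt (g : Ω → EReal) (hg : Measurable g) :
    ∀ᵐ ω ∂P, ofMeasExt P g hg ω = g ω :=
  AEEqFun.coeFn_mk _ _

theorem measurable_L0 (a : L0 P) : Measurable (a : Ω → ℝ) := a.measurable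

theorem measurable_ExtL0 (a : ExtL0 P) : Measurable (a : Ω → EReal) := a.measurable

instance instIsOrderedAddMonoidL0 : IsOrderedAddMonoid (L0 P) where
  add_le_add_left a b h c := by
    rw [le_iff_ae] at h ⊢
    filter_upwards [h, ae_add a c, ae_add b c] with ω h h1 h2
    rw [h1, h2]; linarith

theorem zero_le_iff_ae {a : L0 P} : 0 ≤ a ↔ ∀ᵐ ω ∂P, 0 ≤ a ω := by
  rw [le_iff_ae]
  refine eventually_congr ?_
  filter_upwards [ae_zero (P := P)] with ω h
  rw [h]

theorem mul_le_mul_left_L0 {t a b : L0 P} (ht : 0 ≤ t) (h : a ≤ b) : t * a ≤ t * b := by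
  rw [zero_le_iff_ae] at ht
  rw [le_iff_ae] at h ⊢
  filter_upwards [h, ht, ae_mul t a, ae_mul t b] with ω h ht h1 h2
  rw [h1, h2]
  exact mul_le_mul_of_nonneg_left h ht

theorem mul_nonneg_L0 {t a : L0 P} (ht : 0 ≤ t) (h : 0 ≤ a) : 0 ≤ t * a := by
  simpa using mul_le_mul_left_L0 ht h

theorem one_nonneg_L0 : (0 : L0 P) ≤ 1 := by
  rw [zero_le_iff_ae]
  filter_upwards [ae_one (P := P)] with ω h
  simp [h]

theorem StrictPos.nonneg {a : L0 P} (h : StrictPos a) : 0 ≤ a :=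
  zero_le_iff_ae.2 (h.mono fun _ => le_of_lt)

theorem StrictPos.exists_inv {a : L0 P} (h : StrictPos a) :
    ∃ b : L0 P, StrictPos b ∧ b * a = 1 := by
  have hb := ae_ofMeas (P := P) (fun ω => (a ω)⁻¹) (measurable_L0 a).inv
  refine ⟨ofMeas P (fun ω => (a ω)⁻¹) (measurable_L0 a).inv, ?_, ?_⟩
  · filter_upwards [h, hb] with ω h hb
    rw [hb]; positivity
  · apply AEEqFun.ext
    filter_upwards [h, hb, ae_one (P := P),
      ae_mul (ofMeas P (fun ω => (a ω)⁻¹) (measurable_L0 a).inv) a]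
      with ω h hb h1 h2
    rw [h1, h2, hb, inv_mul_cancel₀ h.ne']

theorem strictPos_one : StrictPos (1 : L0 P) := by
  filter_upwards [ae_one (P := P)] with ω h
  simp [h]

theorem StrictPos.nonneg_add {a b : L0 P} (ha : 0 ≤ a) (hb : StrictPos b) :
    StrictPos (a + b) := by
  filter_upwards [zero_le_iff_ae.1 ha, hb, ae_add a b] with ω h1 h2 h3
  rw [h3]; linarith

theorem strictPos_const {c : ℝ} (hc : 0 < c) :
    StrictPos (ofMeas P (fun _ => c) measurable_const) := by
  filter_upwards [ae_ofMeas (P := P) (fun _ => c) measurable_const] with ω h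
  rw [h]; exact hc

theorem ind_nonneg (A : Set Ω) (hA : MeasurableSet A) : 0 ≤ ind P A hA := by
  rw [zero_le_iff_ae]
  filter_upwards [ae_ind (P := P) A hA] with ω h
  by_cases hω : ω ∈ A
  · simp [h.1 hω]
  · simp [h.2 hω]

theorem ind_mul_self (A : Set Ω) (hA : MeasurableSet A) :
    ind P A hA * ind P A hA = ind P A hA := by
  apply AEEqFun.ext
  filter_upwards [ae_ind (P := P) A hA, ae_mul (ind P A hA) (ind P A hA)] with ω h h1
  by_cases hω : ω ∈ A
  · simp [h.1 hω, h1]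
  · simp [h.2 hω, h1]

theorem ind_compl (A : Set Ω) (hA : MeasurableSet A) :
    ind P Aᶜ hA.compl = 1 - ind P A hA := by
  apply AEEqFun.ext
  filter_upwards [ae_ind (P := P) A hA, ae_ind (P := P) Aᶜ hA.compl, ae_one (P := P),
    ae_sub 1 (ind P A hA)] with ω h h' h1 h2
  by_cases hω : ω ∈ A
  · simp [h.1 hω, h1, h'.2 (not_not.2 hω), h2]
  · simp [h.2 hω, h1, h'.1 hω, h2]

theorem ind_mul_of_subset {A B : Set Ω} (hA : MeasurableSet A) (hB : MeasurableSet B)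
    (h : A ⊆ B) : ind P A hA * ind P B hB = ind P A hA := by
  apply AEEqFun.ext
  filter_upwards [ae_ind (P := P) A hA, ae_ind (P := P) B hB,
    ae_mul (ind P A hA) (ind P B hB)] with ω h1 h2 h3
  by_cases hω : ω ∈ A
  · simp [h1.1 hω, h3, h2.1 (h hω)]
  · simp [h1.2 hω, h3]

/-! ### Essential unions and essential infima -/

/-- Exhaustion: a countable union of maximal probability exists because countably many sequences
merge into one, and adjoining one more set cannot increase its measure. -/
theorem exists_seq_ae_cover [IsFiniteMeasure P] {ι : Type*} [Nonempty ι] (A : ι → Set Ω)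
    (hA : ∀ i, MeasurableSet (A i)) :
    ∃ s : ℕ → ι, ∀ i, ∀ᵐ ω ∂P, ω ∈ A i → ∃ n, ω ∈ A (s n) := by
  let T : Set ENNReal := Set.range fun s : ℕ → ι => P (⋃ n, A (s n))
  have hT : T.Nonempty := Set.range_nonempty _
  obtain ⟨u, -, hu, huT⟩ := exists_seq_tendsto_sSup hT (OrderTop.bddAbove T)
  choose r hr using huT
  let s : ℕ → ι := fun n => r n.unpair.1 n.unpair.2
  have hsub : ∀ k, (⋃ n, A (r k n)) ⊆ ⋃ n, A (s n) := by
    intro k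
    refine Set.iUnion_subset fun n => ?_
    have : A (r k n) = A (s (Nat.pair k n)) := by simp [s]
    rw [this]
    exact Set.subset_iUnion (fun n => A (s n)) _
  have hmax : sSup T ≤ P (⋃ n, A (s n)) := by
    refine le_of_tendsto' hu fun k => ?_
    rw [← hr k]
    exact measure_mono (hsub k)
  refine ⟨s, fun i => ?_⟩
  let s' : ℕ → ι := fun n => Nat.casesOn n i s
  have hs' : (⋃ n, A (s' n)) = A i ∪ ⋃ n, A (s n) := by
    ext ω
    simp only [Set.mem_iUnion, Set.mem_union]
    constructor
    · rintro ⟨_ | n, h⟩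
      · exact Or.inl h
      · exact Or.inr ⟨n, h⟩
    · rintro (h | ⟨n, h⟩)
      · exact ⟨0, h⟩
      · exact ⟨n + 1, h⟩
  have hle : P (A i ∪ ⋃ n, A (s n)) ≤ P (⋃ n, A (s n)) := by
    rw [← hs']
    exact (le_sSup (show P (⋃ n, A (s' n)) ∈ T from ⟨s', rfl⟩)).trans hmax
  have hU : MeasurableSet (⋃ n, A (s n)) := MeasurableSet.iUnion fun n => hA _
  have h0 : P (A i \ ⋃ n, A (s n)) = 0 := by
    have h1 : P ((A i ∪ ⋃ n, A (s n)) \ ⋃ n, A (s n)) = 0 := by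
      rw [measure_sdiff Set.subset_union_right hU.nullMeasurableSet (measure_ne_top _ _)]
      exact tsub_eq_zero_of_le hle
    rwa [Set.union_sdiff_right] at h1
  rw [ae_iff]
  refine measure_mono_null ?_ h0
  intro ω hω
  simp only [Set.mem_ofPred_eq, Classical.not_imp, not_exists] at hω
  exact ⟨hω.1, by simpa using hω.2⟩

/-- Countably many indices almost cover all sublevel sets {F i < q}, one family for each rational q;
rational density in the extended reals does the rest. -/
theorem exists_seq_iInf_le [IsFiniteMeasure P] {ι : Type*} [Nonempty ι] (F : ι → ExtL0 P) :
    ∃ s : ℕ → ι, ∀ i, ∀ᵐ ω ∂P, ⨅ n, F (s n) ω ≤ F i ω := by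
  have h : ∀ q : ℚ, ∃ s : ℕ → ι, ∀ i, ∀ᵐ ω ∂P, F i ω < ((q : ℝ) : EReal) →
      ∃ n, F (s n) ω < ((q : ℝ) : EReal) := fun q =>
    exists_seq_ae_cover (fun i => {ω | F i ω < ((q : ℝ) : EReal)})
      fun i => measurableSet_lt (measurable_ExtL0 _) measurable_const
  choose r hr using h
  obtain ⟨e, he⟩ := exists_surjective_nat (ℚ × ℕ)
  refine ⟨fun n => r (e n).1 (e n).2, fun i => ?_⟩
  filter_upwards [ae_all_iff.2 fun q => hr q i] with ω hω
  refine le_of_forall_gt fun c hc => ?_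
  obtain ⟨q, hq1, hq2⟩ := EReal.lt_iff_exists_rat_btwn.1 hc
  obtain ⟨n, hn⟩ := hω q hq1
  obtain ⟨k, hk⟩ := he (q, n)
  refine (iInf_le _ k).trans_lt (lt_trans ?_ hq2)
  simpa [hk] using hn

theorem exists_isGLB_ExtL0 [IsFiniteMeasure P] (S : Set (ExtL0 P)) : ∃ m, IsGLB S m := by
  rcases S.eq_empty_or_nonempty with rfl | hS
  · refine ⟨ofMeasExt P (fun _ => ⊤) measurable_const, by simp, fun b _ => ?_⟩
    rw [le_iff_ae]
    filter_upwards [ae_ofMeasExt (P := P) (fun _ => ⊤) measurable_const] with ω h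
    rw [h]; exact le_top
  · have := hS.to_subtype
    obtain ⟨s, hs⟩ := exists_seq_iInf_le (fun a : S => a.1)
    have hm : Measurable fun ω => ⨅ n, (s n).1 ω := Measurable.iInf fun n => measurable_ExtL0 _
    refine ⟨ofMeasExt P _ hm, fun a ha => ?_, fun b hb => ?_⟩
    · rw [le_iff_ae]
      filter_upwards [ae_ofMeasExt (P := P) _ hm, hs ⟨a, ha⟩] with ω h1 h2
      rw [h1]; exact h2
    · rw [le_iff_ae]
      filter_upwards [ae_ofMeasExt (P := P) _ hm,
        ae_all_iff.2 fun n => le_iff_ae.1 (hb (s n).2)] with ω h1 h2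
      rw [h1]; exact le_iInf h2

/-- Essential infima of families in `L⁰` that are bounded below, and their compatibility with
multiplication by nonnegative elements. -/
theorem exists_isGLB_L0 [IsFiniteMeasure P] {S : Set (L0 P)} (hS : S.Nonempty)
    (hb : BddBelow S) :
    ∃ m, IsGLB S m ∧ ∀ t d : L0 P, 0 ≤ t → (∀ a ∈ S, d ≤ t * a) → d ≤ t * m := by
  obtain ⟨b, hb⟩ := hb
  have := hS.to_subtype
  obtain ⟨s, hs⟩ := exists_seq_iInf_le (fun a : S => toExt a.1)
  have hm : Measurable fun ω => ⨅ n, (s n).1 ω := Measurable.iInf fun n => measurable_L0 _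
  have hbd : ∀ᵐ ω ∂P, ∀ n, b ω ≤ (s n).1 ω := ae_all_iff.2 fun n => le_iff_ae.1 (hb (s n).2)
  refine ⟨ofMeas P _ hm, ⟨fun a ha => ?_, fun c hc => ?_⟩, fun t d ht h => ?_⟩
  · rw [le_iff_ae]
    filter_upwards [ae_ofMeas (P := P) _ hm, hs ⟨a, ha⟩, hbd, ae_toExt a,
      ae_all_iff.2 fun n => ae_toExt (s n).1] with ω h1 h2 h3 h4 h5
    rw [h1]
    simp only [h4, h5] at h2
    have hB : BddBelow (Set.range fun n => (s n).1 ω) := ⟨b ω, by rintro _ ⟨n, rfl⟩; exact h3 n⟩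
    rw [← EReal.coe_le_coe_iff]
    refine le_trans (le_iInf fun n => ?_) h2
    exact EReal.coe_le_coe_iff.2 (ciInf_le hB n)
  · rw [le_iff_ae]
    filter_upwards [ae_ofMeas (P := P) _ hm,
      ae_all_iff.2 fun n => le_iff_ae.1 (hc (s n).2)] with ω h1 h2
    rw [h1]; exact le_ciInf h2
  · rw [le_iff_ae]
    filter_upwards [ae_ofMeas (P := P) _ hm, zero_le_iff_ae.1 ht, ae_mul t (ofMeas P _ hm),
      ae_all_iff.2 fun n => le_iff_ae.1 (h _ (s n).2),
      ae_all_iff.2 fun n => ae_mul t (s n).1] with ω h1 h2 h3 h4 h5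
    rw [h3, h1, Real.mul_iInf_of_nonneg h2]
    exact le_ciInf fun n => (h4 n).trans_eq (h5 n)

end

section

variable {M : Type*} [AddCommGroup M] [Module (L0 P) M]

/-! ### The conditional Hahn-Banach theorem -/

/-- `L⁰`-sublinear functions. -/
structure L0Sublinear (q : M → L0 P) : Prop where
  add_le : ∀ x y, q (x + y) ≤ q x + q y
  smul_le : ∀ t : L0 P, 0 ≤ t → ∀ x, q (t • x) ≤ t * q x

namespace L0Sublinear

variable {q : M → L0 P}

theorem map_zero (hq : L0Sublinear q) : q 0 = 0 := by
  apply le_antisymm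
  · simpa using hq.smul_le 0 le_rfl 0
  · simpa using hq.add_le 0 0

theorem neg_map_neg_le (hq : L0Sublinear q) (x : M) : -q (-x) ≤ q x := by
  have h := hq.add_le x (-x)
  rw [add_neg_cancel, hq.map_zero] at h
  exact neg_le_iff_add_nonneg.2 h

/-- A nonnegative t may vanish on an event and cannot be inverted, but t + 1 can: scale back from (t
+ 1)x, split off x by subadditivity and cancel. -/
theorem map_smul (hq : L0Sublinear q) {t : L0 P} (ht : 0 ≤ t) (x : M) :
    q (t • x) = t * q x := by
  refine le_antisymm (hq.smul_le t ht x) ?_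
  have hs : StrictPos (t + 1) := StrictPos.nonneg_add ht strictPos_one
  obtain ⟨b, hb, hbs⟩ := hs.exists_inv
  have h1 : q x ≤ b * q ((t + 1) • x) := by
    have := hq.smul_le b hb.nonneg ((t + 1) • x)
    rwa [smul_smul, hbs, one_smul] at this
  have h2 := mul_le_mul_left_L0 hs.nonneg h1
  rw [← mul_assoc, mul_comm (t + 1) b, hbs, one_mul, add_smul, one_smul, add_mul, one_mul] at h2
  exact le_of_add_le_add_right (h2.trans (hq.add_le _ _))

/-- The witness is the essential infimum over t ≥ 0 of q(x + ty) - t q(y), bounded below by -q(-x);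
t = 1 gives the value at -y. It serves both to show that minimal sublinear functions are odd and to
fix the value at a prescribed point. -/
theorem exists_le_map_neg_le [IsFiniteMeasure P] (hq : L0Sublinear q) (y : M) :
    ∃ q' : M → L0 P, L0Sublinear q' ∧ q' ≤ q ∧ q' (-y) ≤ -q y := by
  let S : M → Set (L0 P) := fun x => {a | ∃ t : L0 P, 0 ≤ t ∧ a = q (x + t • y) - t * q y}
  have hS : ∀ x, (S x).Nonempty := fun x => ⟨_, 0, le_rfl, rfl⟩
  have hB : ∀ x, BddBelow (S x) := by
    refine fun x => ⟨-q (-x), ?_⟩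
    rintro _ ⟨t, ht, rfl⟩
    have h := hq.add_le (x + t • y) (-x)
    rw [add_neg_cancel_comm, hq.map_smul ht] at h
    rw [le_sub_iff_add_le, neg_add_le_iff_le_add, add_comm]
    exact h
  choose m hm hmt using fun x => exists_isGLB_L0 (hS x) (hB x)
  refine ⟨m, ⟨fun x x' => ?_, fun s hs x => ?_⟩, fun x => ?_, ?_⟩
  · rw [← sub_le_iff_le_add']
    refine (hm x').2 ?_
    rintro _ ⟨t', ht', rfl⟩
    rw [sub_le_iff_le_add, ← sub_le_iff_le_add']
    refine (hm x).2 ?_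
    rintro _ ⟨t, ht, rfl⟩
    rw [sub_le_iff_le_add]
    refine ((hm (x + x')).1 ⟨t + t', add_nonneg ht ht', rfl⟩).trans ?_
    have h := hq.add_le (x + t • y) (x' + t' • y)
    have e : x + x' + (t + t') • y = x + t • y + (x' + t' • y) := by
      rw [add_smul]; abel
    rw [e, sub_le_iff_le_add]
    refine h.trans (le_of_eq ?_)
    ring
  · refine hmt x s _ hs ?_
    rintro _ ⟨t, ht, rfl⟩
    refine ((hm (s • x)).1 ⟨s * t, mul_nonneg_L0 hs ht, rfl⟩).trans ?_
    rw [mul_smul, ← smul_add, hq.map_smul hs, mul_sub, mul_assoc]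
  · refine (hm x).1 ⟨0, le_rfl, ?_⟩
    simp
  · refine (hm (-y)).1 ⟨1, one_nonneg_L0, ?_⟩
    simp [hq.map_zero]

/-- Zorn's lemma for the reversed order. A chain is directed downwards, so its pointwise essential
infimum is again sublinear; comparison with one member y bounds it below by -y(-x). -/
theorem exists_minimal_le [IsFiniteMeasure P] (hq : L0Sublinear q) :
    ∃ f : M → L0 P, L0Sublinear f ∧ f ≤ q ∧ ∀ f', L0Sublinear f' → f' ≤ f → f' = f := by
  let T : Set (M → L0 P)ᵒᵈ := {f | L0Sublinear (OrderDual.ofDual f)}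
  obtain ⟨f, hqf, hf⟩ := zorn_le_nonempty₀ T (fun c hcT hc y hy => by
    let S : M → Set (L0 P) := fun x => (fun f : (M → L0 P)ᵒᵈ => OrderDual.ofDual f x) '' c
    have hS : ∀ x, (S x).Nonempty := fun x => ⟨_, y, hy, rfl⟩
    have hcomp : ∀ f ∈ c, ∀ g ∈ c, ∃ h ∈ c, OrderDual.ofDual h ≤ OrderDual.ofDual f ∧
        OrderDual.ofDual h ≤ OrderDual.ofDual g := by
      intro f hf g hg
      rcases hc.total hf hg with h | h
      · exact ⟨g, hg, h, le_rfl⟩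
      · exact ⟨f, hf, le_rfl, h⟩
    have hB : ∀ x, BddBelow (S x) := by
      refine fun x => ⟨-OrderDual.ofDual y (-x), ?_⟩
      rintro _ ⟨f, hf, rfl⟩
      obtain ⟨h, hh, h1, h2⟩ := hcomp f hf y hy
      refine le_trans ?_ ((L0Sublinear.neg_map_neg_le (hcT hh) x).trans (h1 x))
      exact neg_le_neg (h2 (-x))
    choose m hm hmt using fun x => exists_isGLB_L0 (hS x) (hB x)
    refine ⟨OrderDual.toDual m, ⟨fun x x' => ?_, fun s hs x => ?_⟩, fun f hf x =>
      (hm x).1 ⟨f, hf, rfl⟩⟩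
    · change m (x + x') ≤ m x + m x'
      rw [← sub_le_iff_le_add']
      refine (hm x').2 ?_
      rintro _ ⟨f', hf', rfl⟩
      rw [sub_le_iff_le_add, ← sub_le_iff_le_add']
      refine (hm x).2 ?_
      rintro _ ⟨f, hf, rfl⟩
      rw [sub_le_iff_le_add]
      obtain ⟨h, hh, h1, h2⟩ := hcomp f hf f' hf'
      refine ((hm (x + x')).1 ⟨h, hh, rfl⟩).trans (((hcT hh).add_le x x').trans ?_)
      exact add_le_add (h1 x) (h2 x')
    · refine hmt x s _ hs ?_
      rintro _ ⟨f, hf, rfl⟩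
      exact ((hm (s • x)).1 ⟨f, hf, rfl⟩).trans ((hcT hf).smul_le s hs x))
    (OrderDual.toDual q) hq
  refine ⟨OrderDual.ofDual f, hf.prop, hqf, fun g hg hle => ?_⟩
  exact le_antisymm hle (hf.le_of_ge (y := OrderDual.toDual g) hg hle)

/-- The conditional Hahn-Banach theorem: every `L⁰`-sublinear function is supported by an
`L⁰`-linear one at every point. -/
theorem exists_linear_le [IsFiniteMeasure P] (hq : L0Sublinear q) (z : M) :
    ∃ f : M →ₗ[L0 P] L0 P, (∀ x, f x ≤ q x) ∧ q z ≤ f z := by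
  -- Lowering q at -z first ensures that every linear form below q' is at least q(z) at z.
  obtain ⟨q', hq', hle', hz⟩ := hq.exists_le_map_neg_le z
  obtain ⟨f, hf, hle, hmin⟩ := hq'.exists_minimal_le
  have hneg : ∀ y, f (-y) = -f y := by
    intro y
    obtain ⟨f', hf', hf'le, hy⟩ := hf.exists_le_map_neg_le y
    rw [hmin f' hf' hf'le] at hy
    refine le_antisymm hy ?_
    simpa using hf.neg_map_neg_le (-y)
  have hadd : ∀ x y, f (x + y) = f x + f y := by
    intro x y
    refine le_antisymm (hf.add_le x y) ?_
    have h := hf.add_le (x + y) (-y)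
    rw [hneg, add_neg_cancel_right] at h
    rw [← sub_eq_add_neg, le_sub_iff_add_le] at h
    exact h
  have hsub : ∀ x y, f (x - y) = f x - f y := by
    intro x y
    rw [sub_eq_add_neg, hadd, hneg, sub_eq_add_neg]
  have hsmul : ∀ (t : L0 P) x, f (t • x) = t * f x := by
    intro t x
    have h0 : 0 ≤ |t| := abs_nonneg t
    have h1 : 0 ≤ t + |t| := by
      rw [← neg_le_iff_add_nonneg']
      exact neg_le_abs t
    -- The scalar has no fixed sign, so it is written as a difference of two nonnegative ones.
    have e : t • x = (t + |t|) • x - |t| • x := by rw [add_smul, add_sub_cancel_right]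
    rw [e, hsub, hf.map_smul h1, hf.map_smul h0]
    ring
  refine ⟨⟨⟨f, hadd⟩, hsmul⟩, fun x => (hle x).trans (hle' x), ?_⟩
  have := (hle (-z)).trans hz
  rw [hneg] at this
  exact neg_le_neg_iff.1 this

end L0Sublinear

theorem le_of_forall_strictPos_le_add {a b : L0 P} (h : ∀ ε : L0 P, StrictPos ε → a ≤ b + ε) :
    a ≤ b := by
  have h' : ∀ n : ℕ, ∀ᵐ ω ∂P, a ω ≤ b ω + 1 / ((n : ℝ) + 1) := by
    intro n
    have hn : (0 : ℝ) < 1 / ((n : ℝ) + 1) := by positivity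
    filter_upwards [le_iff_ae.1 (h _ (strictPos_const hn)), ae_ofMeas (P := P) _ measurable_const,
      ae_add b (ofMeas P (fun _ => 1 / ((n : ℝ) + 1)) measurable_const)] with ω h1 h2 h3
    rwa [h3, h2] at h1
  rw [le_iff_ae]
  filter_upwards [ae_all_iff.2 h'] with ω hω
  refine le_of_forall_pos_le_add fun ε hε => ?_
  obtain ⟨n, hn⟩ := exists_nat_one_div_lt hε
  linarith [hω n]

theorem L0Convex.smul_mem {V : Set M} (hV : L0Convex P V) (h0 : (0 : M) ∈ V) {t : L0 P}
    (ht : 0 ≤ t) (ht1 : t ≤ 1) {v : M} (hv : v ∈ V) : t • v ∈ V := by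
  simpa using hV t ht ht1 v hv 0 h0

/-- The conditional gauge of an `L⁰`-convex `L⁰`-absorbent set. -/
theorem exists_gauge [IsFiniteMeasure P] {V : Set M} (hV : L0Convex P V) (h0 : (0 : M) ∈ V)
    (ha : L0Absorbent P V) :
    ∃ g : M → L0 P, L0Sublinear g ∧
      ∀ x, IsGLB {l : L0 P | StrictPos l ∧ ∃ v ∈ V, x = l • v} (g x) := by
  let S : M → Set (L0 P) := fun x => {l : L0 P | StrictPos l ∧ ∃ v ∈ V, x = l • v}
  have hS : ∀ x, (S x).Nonempty := fun x => by
    obtain ⟨l, hl, v, hv, h⟩ := ha x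
    exact ⟨l, hl, v, hv, h⟩
  have hB : ∀ x, BddBelow (S x) := fun x => ⟨0, fun l hl => hl.1.nonneg⟩
  choose g hg hgt using fun x => exists_isGLB_L0 (hS x) (hB x)
  refine ⟨g, ⟨fun x y => ?_, fun t ht x => ?_⟩, hg⟩
  · rw [← sub_le_iff_le_add']
    refine (hg y).2 ?_
    rintro m ⟨hm, w, hw, rfl⟩
    rw [sub_le_iff_le_add, ← sub_le_iff_le_add']
    refine (hg x).2 ?_
    rintro l ⟨hl, v, hv, rfl⟩
    rw [sub_le_iff_le_add]
    have hs : StrictPos (l + m) := StrictPos.nonneg_add hl.nonneg hm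
    obtain ⟨b, hb, hbs⟩ := hs.exists_inv
    have e : 1 - b * l = b * m := by rw [← hbs]; ring
    have hle : b * l ≤ 1 := by
      rw [← sub_nonneg, e]
      exact mul_nonneg_L0 hb.nonneg hm.nonneg
    refine (hg _).1 ⟨hs, _, hV (b * l) (mul_nonneg_L0 hb.nonneg hl.nonneg) hle v hv w hw, ?_⟩
    rw [e, smul_add, smul_smul, smul_smul, ← mul_assoc, ← mul_assoc, mul_comm (l + m), hbs,
      one_mul, one_mul]
  · refine hgt x t _ ht ?_
    rintro l ⟨hl, v, hv, rfl⟩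
    -- The product t l may vanish on an event, so it is an admissible radius only after adding ε.
    refine le_of_forall_strictPos_le_add fun ε hε => ?_
    have htl : 0 ≤ t * l := mul_nonneg_L0 ht hl.nonneg
    have hs : StrictPos (t * l + ε) := StrictPos.nonneg_add htl hε
    obtain ⟨b, hb, hbs⟩ := hs.exists_inv
    have e : 1 - b * (t * l) = b * ε := by rw [← hbs]; ring
    have hle : b * (t * l) ≤ 1 := by
      rw [← sub_nonneg, e]
      exact mul_nonneg_L0 hb.nonneg hε.nonneg
    refine (hg _).1 ⟨hs, _, hV.smul_mem h0 (mul_nonneg_L0 hb.nonneg htl) hle hv, ?_⟩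
    rw [smul_smul, smul_smul, ← mul_assoc, mul_comm (t * l + ε), hbs, one_mul]

/-- Algebraic separation of a point from an `L⁰`-convex set, on an event on which every
localization of the point keeps a distance to the set. -/
theorem exists_linear_separation [IsFiniteMeasure P] {C U : Set M} (hC : L0Convex P C)
    (hCne : C.Nonempty) (hU : L0Convex P U) (hUa : L0Absorbent P U) (hUb : L0Balanced P U)
    (hU0 : (0 : M) ∈ U) (X : M)
    {A : Set Ω} (hA : MeasurableSet A)
    (hsep : ∀ (B : Set Ω) (hB : MeasurableSet B), B ⊆ A → 0 < P B → ∀ c ∈ C, ∀ u ∈ U,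
      ind P B hB • (c - X) ≠ ind P B hB • u) :
    ∃ f : M →ₗ[L0 P] L0 P, (∀ u ∈ U, |f u| ≤ 1) ∧
      ∃ u ∈ U, (∀ᵐ ω ∂P, ω ∈ A → 0 < f u ω) ∧
        ∀ c ∈ C, ∀ᵐ ω ∂P, ω ∈ A → f X ω + f u ω ≤ f c ω := by
  obtain ⟨c₀, hc₀⟩ := hCne
  -- Separating X from `C` amounts to bounding the gauge of U + c₀ - C at c₀ - X below by 1 on A.
  let V : Set M := {v | ∃ u ∈ U, ∃ c ∈ C, v = u + c₀ - c}
  have hUV : U ⊆ V := fun u hu => ⟨u, hu, c₀, hc₀, by simp⟩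
  have h0 : (0 : M) ∈ V := hUV hU0
  have hV : L0Convex P V := by
    rintro l hl hl1 _ ⟨u, hu, c, hc, rfl⟩ _ ⟨u', hu', c', hc', rfl⟩
    refine ⟨_, hU l hl hl1 u hu u' hu', _, hC l hl hl1 c hc c' hc', ?_⟩
    module
  have hVa : L0Absorbent P V := fun x => by
    obtain ⟨l, hl, u, hu, h⟩ := hUa x
    exact ⟨l, hl, u, hUV hu, h⟩
  obtain ⟨g, hg, hgl⟩ := exists_gauge hV h0 hVa
  obtain ⟨f, hfg, hfz⟩ := hg.exists_linear_le (c₀ - X)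
  have hV1 : ∀ v ∈ V, f v ≤ 1 := fun v hv =>
    (hfg v).trans ((hgl v).1 ⟨strictPos_one, v, hv, by simp⟩)
  have hz : ∀ᵐ ω ∂P, ω ∈ A → 1 ≤ f (c₀ - X) ω := by
    let m : L0 P := ind P A hA
    have hm : m ≤ g (c₀ - X) := by
      refine (hgl _).2 ?_
      rintro l ⟨hl, v, hv, hzl⟩
      -- On the part of A where l < 1, the localized point c₀ - X is itself in V, so some c - X
      -- agrees there with an element of U; the hypothesis makes this part null.
      have hBm : MeasurableSet (A ∩ {ω | l ω < 1}) :=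
        hA.inter (measurableSet_lt (measurable_L0 l) measurable_const)
      have hB0 : P (A ∩ {ω | l ω < 1}) = 0 := by
        by_contra hne
        have hl' : 0 ≤ ind P _ hBm * l := mul_nonneg_L0 (ind_nonneg _ _) hl.nonneg
        have hl1 : ind P _ hBm * l ≤ 1 := by
          rw [le_iff_ae]
          filter_upwards [ae_ind (P := P) _ hBm, ae_mul (ind P _ hBm) l, ae_one (P := P)]
            with ω h1 h2 h3
          rw [h2, h3]
          by_cases hω : ω ∈ A ∩ {ω | l ω < 1}
          · rw [h1.1 hω, one_mul]; exact le_of_lt hω.2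
          · rw [h1.2 hω, zero_mul]; exact zero_le_one
        obtain ⟨u, hu, c, hc, huc⟩ := hV.smul_mem h0 hl' hl1 hv
        refine hsep _ hBm Set.inter_subset_left (pos_iff_ne_zero.2 hne) c hc u hu ?_
        have h1 : ind P _ hBm • (c₀ - X) = ind P _ hBm • (u + c₀ - c) := by
          rw [← huc, hzl, smul_smul, smul_smul, ← mul_assoc, ind_mul_self]
        have h2 : c - X = (c₀ - X) - (u + c₀ - c) + u := by abel
        rw [h2, smul_add, smul_sub, h1, sub_self, zero_add]
      rw [le_iff_ae]
      have hB : ∀ᵐ ω ∂P, ω ∉ A ∩ {ω | l ω < 1} := measure_eq_zero_iff_ae_notMem.1 hB0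
      filter_upwards [hB, ae_ind (P := P) A hA, hl] with ω h1 h2 h3
      by_cases hω : ω ∈ A
      · rw [h2.1 hω]
        by_contra hlt
        exact h1 ⟨hω, not_le.1 hlt⟩
      · rw [h2.2 hω]; exact h3.le
    filter_upwards [le_iff_ae.1 (hm.trans hfz), ae_ind (P := P) A hA] with ω h1 h2 hω
    rwa [h2.1 hω] at h1
  obtain ⟨l, hl, u, hu, hzu⟩ := hUa (c₀ - X)
  refine ⟨f, fun u hu => ?_, u, hu, ?_, fun c hc => ?_⟩
  · refine abs_le'.2 ⟨hV1 u (hUV hu), ?_⟩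
    have h1 : (-1 : L0 P) • u ∈ U := hUb (-1) (by
      rw [abs_neg, abs_of_nonneg one_nonneg_L0]) u hu
    have h2 := hV1 _ (hUV h1)
    rwa [neg_one_smul, _root_.map_neg] at h2
  · have e : f (c₀ - X) = l * f u := by rw [hzu, _root_.map_smul, smul_eq_mul]
    filter_upwards [hz, hl, ae_mul l (f u)] with ω h1 h2 h3 hω
    have h4 := h1 hω
    rw [e, h3] at h4
    by_contra hn
    nlinarith [not_lt.1 hn]
  · have h1 := hV1 (u + c₀ - c) ⟨u, hu, c, hc, rfl⟩
    rw [map_sub, map_add] at h1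
    filter_upwards [le_iff_ae.1 h1, hz, ae_sub (f u + f c₀) (f c), ae_add (f u) (f c₀),
      ae_one (P := P), ae_sub (f c₀) (f X)] with ω h1 h2 h3 h4 h5 h6 hω
    have h7 := h2 hω
    rw [map_sub, h6] at h7
    rw [h3, h4, h5] at h1
    linarith

end

section

/-! ### Countable gluing -/

/-- The partition obtained from a sequence of events by disjointing them and adding the
complement of their union. -/
def coverPartition (A : ℕ → Set Ω) (hA : ∀ n, MeasurableSet (A n)) : EventPartition Ω where
  set n := Nat.casesOn n (⋃ k, A k)ᶜ (disjointed A)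
  measurable n := by
    cases n with
    | zero => exact (MeasurableSet.iUnion hA).compl
    | succ n => exact MeasurableSet.disjointed hA n
  disjoint := by
    have h : ∀ n, disjointed A n ⊆ ⋃ k, A k := fun n =>
      (disjointed_subset A n).trans (Set.subset_iUnion A n)
    intro i j hij
    cases i with
    | zero =>
      cases j with
      | zero => exact absurd rfl hij
      | succ j => exact (Set.disjoint_compl_left_iff_subset.2 (h j))
    | succ i =>
      cases j with
      | zero => exact (Set.disjoint_compl_right_iff_subset.2 (h i))
      | succ j => exact disjoint_disjointed A (fun h => hij (by rw [h]))
  cover := by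
    rw [Set.eq_univ_iff_forall]
    intro ω
    rw [Set.mem_iUnion]
    by_cases hω : ω ∈ ⋃ k, A k
    · rw [← iUnion_disjointed, Set.mem_iUnion] at hω
      obtain ⟨n, hn⟩ := hω
      exact ⟨n + 1, hn⟩
    · exact ⟨0, hω⟩

theorem EventPartition.exists_mem (A : EventPartition Ω) (ω : Ω) : ∃ i, ω ∈ A.set i := by
  have := A.cover
  rw [Set.eq_univ_iff_forall] at this
  simpa using this ω

theorem ind_mul_eq_iff {A : Set Ω} (hA : MeasurableSet A) {a b : L0 P} :
    ind P A hA * a = ind P A hA * b ↔ ∀ᵐ ω ∂P, ω ∈ A → a ω = b ω := by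
  constructor
  · intro h
    filter_upwards [ae_mul (ind P A hA) a, ae_mul (ind P A hA) b, ae_ind (P := P) A hA]
      with ω h1 h2 h3 hω
    rw [h, h2, h3.1 hω] at h1
    simpa using h1.symm
  · intro h
    apply AEEqFun.ext
    filter_upwards [ae_mul (ind P A hA) a, ae_mul (ind P A hA) b, ae_ind (P := P) A hA, h]
      with ω h1 h2 h3 h
    rw [h1, h2]
    by_cases hω : ω ∈ A
    · rw [h hω]
    · simp [h3.2 hω]

theorem exists_glue_L0 (A : EventPartition Ω) (a : ℕ → L0 P) :
    ∃ b : L0 P, ∀ i, ∀ᵐ ω ∂P, ω ∈ A.set i → b ω = a i ω := by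
  obtain ⟨g, hg, hgi⟩ := exists_measurable_piecewise A.set A.measurable (fun i => (a i : Ω → ℝ))
    (fun i => measurable_L0 _) (by
      intro i j hij ω hω
      exact absurd hω.2 (Set.disjoint_left.1 (A.disjoint hij) hω.1))
  refine ⟨ofMeas P g hg, fun i => ?_⟩
  filter_upwards [ae_ofMeas (P := P) g hg] with ω h hω
  rw [h]; exact hgi i hω

variable {E : Type*} [AddCommGroup E] [Module (L0 P) E] [TopologicalSpace E]
  [IsTopologicalAddGroup E] [ContinuousSMul (L0 P) E]

/-- Both Y and 0 concatenate the zero sequence, and concatenations are unique. -/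
theorem CondLocallyConvex.eq_zero (hE : CondLocallyConvex P E) (A : EventPartition Ω) {Y : E}
    (h : ∀ i, ind P (A.set i) (A.measurable i) • Y = 0) : Y = 0 := by
  obtain ⟨Z, -, hZ⟩ := hE.existsUnique_concat A (fun _ => 0)
  rw [hZ Y (fun i => by rw [h i, smul_zero]), hZ 0 (fun i => rfl)]

/-- A continuous linear form out of one that is bounded on a neighbourhood of `0`. -/
theorem exists_weakDual_of_bounded (f : E →ₗ[L0 P] L0 P) {U : Set E} (hU : U ∈ 𝓝 (0 : E))
    (hf : ∀ u ∈ U, |f u| ≤ 1) : ∃ F : WeakDual (L0 P) E, ∀ x, F x = f x := by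
  have hc : Continuous f := by
    refine continuous_of_continuousAt_zero f ?_
    rw [ContinuousAt, map_zero, nhds_zero_hasBasis_L0.tendsto_right_iff]
    intro ε hε
    obtain ⟨b, hb, hbε⟩ := hε.exists_inv
    have hm : (fun x : E => b • x) ⁻¹' U ∈ 𝓝 (0 : E) := by
      refine (continuous_const_smul b).continuousAt.preimage_mem_nhds ?_
      rwa [smul_zero]
    filter_upwards [hm] with x hx
    have e : f x = ε * f (b • x) := by
      rw [map_smul, smul_eq_mul, ← mul_assoc, mul_comm ε b, hbε, one_mul]
    rw [mem_ball0, e]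
    filter_upwards [ae_mul ε (f (b • x)), le_iff_ae.1 (hf _ hx), AEEqFun.coeFn_abs (f (b • x)),
      ae_one (P := P), hε] with ω h1 h2 h3 h4 h5
    rw [h3, h4] at h2
    rw [h1, abs_mul, abs_of_pos h5]
    exact mul_le_of_le_one_right h5.le h2
  exact ⟨StrongDual.toWeakDual ⟨f, hc⟩, fun x => rfl⟩

/-- Continuity is where the third axiom enters: concatenating the neighbourhoods {|f i| ≤ 1} gives a
neighbourhood of 0 on which the glued form is bounded by 1. -/
theorem exists_glue_weakDual (hE : CondLocallyConvex P E) (A : EventPartition Ω)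
    (f : ℕ → WeakDual (L0 P) E) :
    ∃ F : WeakDual (L0 P) E, ∀ i x, ∀ᵐ ω ∂P, ω ∈ A.set i → F x ω = f i x ω := by
  choose F hF using fun x => exists_glue_L0 A (fun i => f i x)
  have hadd : ∀ x y, F (x + y) = F x + F y := by
    intro x y
    apply AEEqFun.ext
    filter_upwards [ae_all_iff.2 (hF x), ae_all_iff.2 (hF y), ae_all_iff.2 (hF (x + y)),
      ae_add (F x) (F y), ae_all_iff.2 fun i => ae_add (f i x) (f i y)] with ω h1 h2 h3 h4 h5
    obtain ⟨i, hi⟩ := A.exists_mem ω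
    rw [h4, h1 i hi, h2 i hi, h3 i hi, map_add, h5]
  have hsmul : ∀ (t : L0 P) x, F (t • x) = t • F x := by
    intro t x
    apply AEEqFun.ext
    rw [smul_eq_mul]
    filter_upwards [ae_all_iff.2 (hF x), ae_all_iff.2 (hF (t • x)),
      ae_mul t (F x), ae_all_iff.2 fun i => ae_mul t (f i x)] with ω h1 h3 h4 h5
    obtain ⟨i, hi⟩ := A.exists_mem ω
    rw [h4, h1 i hi, h3 i hi, map_smul, smul_eq_mul, h5]
  let L : E →ₗ[L0 P] L0 P := ⟨⟨F, hadd⟩, hsmul⟩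
  have hU : ∀ i, (f i) ⁻¹' ball0 1 ∈ 𝓝 (0 : E) := fun i => by
    refine (map_continuous (f i)).continuousAt.preimage_mem_nhds ?_
    rw [map_zero]
    exact nhds_zero_hasBasis_L0.mem_of_mem strictPos_one
  obtain ⟨G, hG⟩ := exists_weakDual_of_bounded L (hE.concat_nhds A _ hU) (by
    rintro Y ⟨X, hX, hY⟩
    change Y ∈ L ⁻¹' ball0 1
    rw [Set.mem_preimage, mem_ball0]
    have h1 : ∀ i, ∀ᵐ ω ∂P, ω ∈ A.set i → f i Y ω = f i (X i) ω := fun i => by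
      rw [← ind_mul_eq_iff (A.measurable i)]
      have := congrArg (f i) (hY i)
      rwa [map_smul, map_smul] at this
    have h2 : ∀ i, ∀ᵐ ω ∂P, |f i (X i) ω| ≤ (1 : L0 P) ω := fun i => mem_ball0.1 (hX i)
    filter_upwards [ae_all_iff.2 h1, ae_all_iff.2 h2, ae_all_iff.2 (hF Y)] with ω h1 h2 h3
    obtain ⟨i, hi⟩ := A.exists_mem ω
    change |F Y ω| ≤ _
    rw [h3 i hi, h1 i hi]
    exact h2 i)
  exact ⟨G, fun i x => by rw [hG]; exact hF x i⟩

/-! ### Separation of a point from a closed set -/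

/-- If a `σ`-stable set misses a `σ`-stable neighbourhood of a point, it does so on every small
event inside some event of positive probability. -/
theorem exists_event_disjoint [IsProbabilityMeasure P] (hE : CondLocallyConvex P E) {C U : Set E}
    (hCne : C.Nonempty) (hCstable : SigmaStable P C) (hU0 : (0 : E) ∈ U)
    (hUstable : SigmaStable P U) {X : E} (hX : ∀ u ∈ U, X + u ∉ C) :
    ∃ A : Set Ω, MeasurableSet A ∧ 0 < P A ∧
      ∀ (B : Set Ω) (hB : MeasurableSet B), B ⊆ A → 0 < P B → ∀ c ∈ C, ∀ u ∈ U,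
        ind P B hB • (c - X) ≠ ind P B hB • u := by
  obtain ⟨c₀, hc₀⟩ := hCne
  -- The bad events, on which some point of `C` agrees with a point of X + U. Their essential union
  -- cannot be all of Ω, since gluing the witnesses would give a point of `C` in X + U; its
  -- complement is the required event.
  let ι := {B : Set Ω // ∃ hB : MeasurableSet B, ∃ c ∈ C, ∃ u ∈ U,
    ind P B hB • (c - X) = ind P B hB • u}
  have hempty : ind P (∅ : Set Ω) MeasurableSet.empty = 0 := by
    apply AEEqFun.ext
    filter_upwards [ae_ind (P := P) ∅ MeasurableSet.empty, ae_zero (P := P)] with ω h1 h2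
    rw [h1.2 (by simp), h2]
  have : Nonempty ι := ⟨⟨∅, MeasurableSet.empty, c₀, hc₀, 0, hU0, by simp [hempty]⟩⟩
  obtain ⟨s, hs⟩ := exists_seq_ae_cover (P := P) (fun i : ι => i.1) (fun i => i.2.choose)
  have hm : ∀ n, MeasurableSet (s n).1 := fun n => (s n).2.choose
  choose hm' c hc u hu hcu using fun n => (s n).2
  let Q := coverPartition (fun n => (s n).1) hm
  have hD : MeasurableSet (⋃ n, (s n).1) := MeasurableSet.iUnion hm
  refine ⟨(⋃ n, (s n).1)ᶜ, hD.compl, ?_, fun B hB hBA hPB d hd v hv h => ?_⟩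
  · by_contra h0
    obtain ⟨Y, hY, -⟩ := hE.existsUnique_concat Q (fun n => Nat.casesOn n c₀ c)
    obtain ⟨W, hW, -⟩ := hE.existsUnique_concat Q (fun n => Nat.casesOn n 0 u)
    have hYC : Y ∈ C := hCstable Q _ (by rintro (_ | n); exacts [hc₀, hc n]) Y hY
    have hWU : W ∈ U := hUstable Q _ (by rintro (_ | n); exacts [hU0, hu n]) W hW
    have hz : Y - X - W = 0 := by
      refine hE.eq_zero Q fun i => ?_
      cases i with
      | zero =>
        have : ind P (Q.set 0) (Q.measurable 0) = 0 := by
          apply AEEqFun.ext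
          have h1 : ∀ᵐ ω ∂P, ω ∉ (⋃ n, (s n).1)ᶜ :=
            measure_eq_zero_iff_ae_notMem.1 (le_antisymm (not_lt.1 h0) bot_le)
          filter_upwards [ae_ind (P := P) (Q.set 0) (Q.measurable 0), ae_zero (P := P), h1]
            with ω h1 h2 h3
          rw [h1.2 h3, h2]
        rw [this, zero_smul]
      | succ n =>
        have e1 := hY (n + 1)
        have e2 := hW (n + 1)
        have e3 : ind P (Q.set (n + 1)) (Q.measurable (n + 1)) • (c n - X) =
            ind P (Q.set (n + 1)) (Q.measurable (n + 1)) • u n := by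
          have hsub : Q.set (n + 1) ⊆ (s n).1 := disjointed_subset (fun n => (s n).1) n
          rw [← ind_mul_of_subset (Q.measurable (n + 1)) (hm' n) hsub, mul_smul, mul_smul, hcu]
        rw [smul_sub, smul_sub, e1, e2]
        rw [smul_sub] at e3
        rw [e3, sub_self]
    refine hX W hWU ?_
    have : X + W = Y := by
      rw [sub_sub, sub_eq_zero] at hz
      exact hz.symm
    rwa [this]
  · have h1 := hs ⟨B, hB, d, hd, v, hv, h⟩
    have h2 : P B = 0 := by
      rw [measure_eq_zero_iff_ae_notMem]
      filter_upwards [h1] with ω h1 hω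
      obtain ⟨n, hn⟩ := h1 hω
      exact hBA hω (Set.mem_iUnion.2 ⟨n, hn⟩)
    rw [h2] at hPB
    exact lt_irrefl 0 hPB

/-- Conditional strict separation of a point from a closed `L⁰`-convex `σ`-stable set. -/
theorem exists_weakDual_separation [IsProbabilityMeasure P] (hE : CondLocallyConvex P E)
    {C : Set E} (hCne : C.Nonempty) (hCclosed : IsClosed C) (hCconvex : L0Convex P C)
    (hCstable : SigmaStable P C) {X : E} (hX : X ∉ C) :
    ∃ A : Set Ω, MeasurableSet A ∧ 0 < P A ∧ ∃ (f : WeakDual (L0 P) E) (e : L0 P),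
      (∀ᵐ ω ∂P, ω ∈ A → 0 < e ω) ∧ ∀ c ∈ C, ∀ᵐ ω ∂P, ω ∈ A → f X ω + e ω ≤ f c ω := by
  have hN : {y : E | X + y ∉ C} ∈ 𝓝 (0 : E) := by
    refine (continuous_const_add X).continuousAt.preimage_mem_nhds
      (hCclosed.isOpen_compl.mem_nhds ?_)
    simpa using hX
  obtain ⟨U, hU, hUN, hUc, hUa, hUb, hUs⟩ := hE.exists_nhds _ hN
  have hU0 := mem_of_mem_nhds hU
  obtain ⟨A, hA, hPA, hsep⟩ := exists_event_disjoint hE hCne hCstable hU0 hUs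
    (fun u hu => hUN hu)
  obtain ⟨f, hf1, u, hu, hpos, hf⟩ :=
    exists_linear_separation hCconvex hCne hUc hUa hUb hU0 X hA hsep
  obtain ⟨F, hF⟩ := exists_weakDual_of_bounded f hU hf1
  refine ⟨A, hA, hPA, F, f u, hpos, fun c hc => ?_⟩
  rw [hF, hF]
  exact hf c hc

end

section

/-! ### The support function of a set -/

/-- Balls of constant radius 1/(n + 1) suffice: a closure point satisfies the bound up to each such
error, for countably many n at once. -/
theorem isClosed_le_toExt (m : ExtL0 P) : IsClosed {a : L0 P | m ≤ toExt a} := by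
  refine isClosed_of_closure_subset fun a ha => ?_
  have h : ∀ n : ℕ, ∀ᵐ ω ∂P, m ω ≤ ((a ω + 1 / ((n : ℝ) + 1) : ℝ) : EReal) := by
    intro n
    have hn : (0 : ℝ) < 1 / ((n : ℝ) + 1) := by positivity
    have hN : {y : L0 P | y - a ∈ ball0 (ofMeas P (fun _ => 1 / ((n : ℝ) + 1)) measurable_const)} ∈
        𝓝 a := by
      refine (continuous_id.sub continuous_const).continuousAt.preimage_mem_nhds ?_
      change _ ∈ 𝓝 (a - a)
      rw [sub_self]
      exact nhds_zero_hasBasis_L0.mem_of_mem (strictPos_const hn)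
    obtain ⟨y, hy, hym⟩ := mem_closure_iff_nhds.1 ha _ hN
    filter_upwards [mem_ball0.1 hy, le_iff_ae.1 hym, ae_toExt y, ae_sub y a,
      ae_ofMeas (P := P) (fun _ => 1 / ((n : ℝ) + 1)) measurable_const] with ω h1 h2 h3 h4 h5
    rw [h4, h5] at h1
    rw [h3] at h2
    refine h2.trans (EReal.coe_le_coe_iff.2 ?_)
    linarith [(abs_le.1 h1).2]
  change m ≤ toExt a
  rw [le_iff_ae]
  filter_upwards [ae_all_iff.2 h, ae_toExt a] with ω h1 h2
  rw [h2]
  have hlim : Tendsto (fun n : ℕ => ((a ω + 1 / ((n : ℝ) + 1) : ℝ) : EReal)) atTop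
      (𝓝 ((a ω : ℝ) : EReal)) := by
    refine (continuous_coe_real_ereal.tendsto _).comp ?_
    simpa using (tendsto_const_nhds (x := a ω)).add
      (tendsto_one_div_add_atTop_nhds_zero_nat (𝕜 := ℝ))
  exact ge_of_tendsto' hlim h1

theorem MonotoneSet.add_mem {F : Type*} [AddCommGroup F] {K C : Set F} (h : MonotoneSet K C) {X Y : F} (hX : X ∈ C)
    (hY : Y ∈ K) : X + Y ∈ C := by
  rw [MonotoneSet] at h
  rw [← h]
  exact ⟨X, hX, Y, hY, rfl⟩

section

variable {E : Type*} [AddCommGroup E] [Module (L0 P) E] [TopologicalSpace E]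

theorem ae_smul_weakDual (l : L0 P) (f : WeakDual (L0 P) E) (x : E) :
    ∀ᵐ ω ∂P, (l • f) x ω = l ω * f x ω := ae_mul l (f x)

theorem ae_smul_add_smul_weakDual (l m : L0 P) (f g : WeakDual (L0 P) E) (x : E) :
    ∀ᵐ ω ∂P, (l • f + m • g) x ω = l ω * f x ω + m ω * g x ω := by
  filter_upwards [ae_add ((l • f) x) ((m • g) x), ae_smul_weakDual l f x, ae_smul_weakDual m g x]
    with ω h1 h2 h3
  rw [← h2, ← h3, ← h1]
  rfl

theorem ae_glue_weakDual {A : Set Ω} (hA : MeasurableSet A) (f g : WeakDual (L0 P) E) (x : E) :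
    ∀ᵐ ω ∂P, (ω ∈ A → (ind P A hA • f + ind P Aᶜ hA.compl • g) x ω = f x ω) ∧
      (ω ∉ A → (ind P A hA • f + ind P Aᶜ hA.compl • g) x ω = g x ω) := by
  filter_upwards [ae_smul_add_smul_weakDual (ind P A hA) (ind P Aᶜ hA.compl) f g x,
    ae_ind (P := P) A hA, ae_ind (P := P) Aᶜ hA.compl] with ω h1 h2 h3
  refine ⟨fun hω => ?_, fun hω => ?_⟩
  · rw [h1, h2.1 hω, h3.2 (not_not.2 hω)]; ring
  · rw [h1, h2.2 hω, h3.1 hω]; ring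

theorem zero_mem_polarCone (K : Set E) : (0 : WeakDual (L0 P) E) ∈ polarCone P K :=
  fun _ _ => le_rfl

theorem mem_polarCone_iff {K : Set E} {f : WeakDual (L0 P) E} :
    f ∈ polarCone P K ↔ ∀ X ∈ K, ∀ᵐ ω ∂P, 0 ≤ f X ω :=
  forall₂_congr fun _ _ => zero_le_iff_ae

theorem glue_mem_polarCone {K : Set E} {A : Set Ω} (hA : MeasurableSet A)
    {f g : WeakDual (L0 P) E} (hf : f ∈ polarCone P K) (hg : g ∈ polarCone P K) :
    ind P A hA • f + ind P Aᶜ hA.compl • g ∈ polarCone P K := by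
  rw [mem_polarCone_iff] at *
  intro X hX
  filter_upwards [hf X hX, hg X hX, ae_glue_weakDual hA f g X] with ω h1 h2 h3
  by_cases hω : ω ∈ A
  · rwa [h3.1 hω]
  · rwa [h3.2 hω]

theorem smul_add_smul_mem_polarCone {K : Set E} {l m : L0 P} (hl : 0 ≤ l) (hm : 0 ≤ m)
    {f g : WeakDual (L0 P) E} (hf : f ∈ polarCone P K) (hg : g ∈ polarCone P K) :
    l • f + m • g ∈ polarCone P K := fun X hX =>
  add_nonneg (mul_nonneg_L0 hl (hf X hX)) (mul_nonneg_L0 hm (hg X hX))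

theorem smul_mem_polarCone {K : Set E} {l : L0 P} (hl : 0 ≤ l)
    {f : WeakDual (L0 P) E} (hf : f ∈ polarCone P K) : l • f ∈ polarCone P K := fun X hX =>
  mul_nonneg_L0 hl (hf X hX)

/-- `p` is the essential infimum of the evaluations at the points of `C`. -/
def IsSupport (C : Set E) (p : WeakDual (L0 P) E → ExtL0 P) : Prop :=
  ∀ f, IsGLB ((fun X => toExt (f X)) '' C) (p f)

namespace IsSupport

variable {C : Set E} {p : WeakDual (L0 P) E → ExtL0 P}

theorem ae_le (hp : IsSupport C p) (f : WeakDual (L0 P) E) {X : E} (hX : X ∈ C) :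
    ∀ᵐ ω ∂P, p f ω ≤ (f X ω : EReal) := by
  filter_upwards [le_iff_ae.1 ((hp f).1 ⟨X, hX, rfl⟩), ae_toExt (f X)] with ω h1 h2
  rwa [h2] at h1

theorem le_iff (hp : IsSupport C p) {m : ExtL0 P} {f : WeakDual (L0 P) E} :
    m ≤ p f ↔ ∀ X ∈ C, m ≤ toExt (f X) := by
  rw [le_isGLB_iff (hp f)]
  simp [lowerBounds]

theorem ae_le_of_forall (hp : IsSupport C p) {g : Ω → EReal} (hg : Measurable g)
    {f : WeakDual (L0 P) E} (h : ∀ X ∈ C, ∀ᵐ ω ∂P, g ω ≤ (f X ω : EReal)) :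
    ∀ᵐ ω ∂P, g ω ≤ p f ω := by
  have h1 : ofMeasExt P g hg ≤ p f := by
    rw [hp.le_iff]
    intro X hX
    rw [le_iff_ae]
    filter_upwards [h X hX, ae_toExt (f X), ae_ofMeasExt (P := P) g hg] with ω h1 h2 h3
    rwa [h2, h3]
  filter_upwards [le_iff_ae.1 h1, ae_ofMeasExt (P := P) g hg] with ω h1 h2
  rwa [h2] at h1

/-- The function equal to p f on A and to p g off A is a lower bound for the evaluations of g on
`C`. -/
theorem ae_mono_on (hp : IsSupport C p) {A : Set Ω} (hA : MeasurableSet A)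
    {f g : WeakDual (L0 P) E} (h : ∀ X ∈ C, ∀ᵐ ω ∂P, ω ∈ A → f X ω = g X ω) :
    ∀ᵐ ω ∂P, ω ∈ A → p f ω ≤ p g ω := by
  classical
  have h1 := hp.ae_le_of_forall (f := g) (g := A.piecewise (p f) (p g))
    (Measurable.piecewise hA (measurable_ExtL0 _) (measurable_ExtL0 _)) (fun X hX => by
      filter_upwards [h X hX, hp.ae_le f hX, hp.ae_le g hX] with ω h1 h2 h3
      by_cases hω : ω ∈ A
      · rw [Set.piecewise_eq_of_mem _ _ _ hω, ← h1 hω]; exact h2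
      · rw [Set.piecewise_eq_of_notMem _ _ _ hω]; exact h3)
  filter_upwards [h1] with ω h1 hω
  rwa [Set.piecewise_eq_of_mem _ _ _ hω] at h1

theorem localOn (hp : IsSupport C p) (S : Set (WeakDual (L0 P) E)) : LocalOn S p := by
  intro A hA f _ g _
  have h1 := fun X => ae_glue_weakDual hA f g X
  have e1 : ∀ X, ∀ᵐ ω ∂P, ω ∈ A →
      (ind P A hA • f + ind P Aᶜ hA.compl • g) X ω = f X ω := fun X => (h1 X).mono fun _ h => h.1
  have e2 : ∀ X, ∀ᵐ ω ∂P, ω ∈ Aᶜ →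
      (ind P A hA • f + ind P Aᶜ hA.compl • g) X ω = g X ω := fun X => (h1 X).mono fun _ h => h.2
  filter_upwards [hp.ae_mono_on hA (fun X _ => e1 X),
    hp.ae_mono_on hA (fun X _ => (e1 X).mono fun _ h hω => (h hω).symm),
    hp.ae_mono_on hA.compl (fun X _ => e2 X),
    hp.ae_mono_on hA.compl (fun X _ => (e2 X).mono fun _ h hω => (h hω).symm)]
    with ω h1 h2 h3 h4
  exact ⟨fun hω => le_antisymm (h1 hω) (h2 hω), fun hω => le_antisymm (h3 hω) (h4 hω)⟩

theorem mul_le (hp : IsSupport C p) {l : L0 P} (hl : 0 ≤ l) (f : WeakDual (L0 P) E) :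
    ∀ᵐ ω ∂P, (l ω : EReal) * p f ω ≤ p (l • f) ω := by
  refine hp.ae_le_of_forall ((measurable_L0 l).coe_real_ereal.mul (measurable_ExtL0 _))
    fun X hX => ?_
  filter_upwards [hp.ae_le f hX, zero_le_iff_ae.1 hl, ae_smul_weakDual l f X] with ω h1 h2 h3
  rw [h3, EReal.coe_mul]
  exact mul_le_mul_of_nonneg_left h1 (EReal.coe_nonneg.2 h2)

/-- The inequality `mul_le` is applied to l and to its inverse. -/
theorem posHomogeneousOn (hp : IsSupport C p) (S : Set (WeakDual (L0 P) E)) :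
    PosHomogeneousOn S p := by
  intro l hl f _
  obtain ⟨b, hb, hbl⟩ := hl.exists_inv
  have h1 := hp.mul_le hb.nonneg (l • f)
  rw [smul_smul, hbl, one_smul] at h1
  have h2 : ∀ᵐ ω ∂P, b ω * l ω = 1 := by
    filter_upwards [ae_mul b l, ae_one (P := P)] with ω h1 h2
    rw [← h1, hbl, h2]
  filter_upwards [h1, h2, hp.mul_le hl.nonneg f, hl] with ω h1 h2 h3 h4
  refine le_antisymm ?_ h3
  have h5 := mul_le_mul_of_nonneg_left h1 (EReal.coe_nonneg.2 h4.le)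
  rwa [← mul_assoc, ← EReal.coe_mul, mul_comm (l ω), h2, EReal.coe_one, one_mul] at h5

theorem l0ConcaveOn (hp : IsSupport C p) (S : Set (WeakDual (L0 P) E)) : L0ConcaveOn S p := by
  intro l hl hl1 f _ g _
  refine hp.ae_le_of_forall (((measurable_L0 l).coe_real_ereal.mul (measurable_ExtL0 _)).add
    (((measurable_const.sub (measurable_L0 l)).coe_real_ereal).mul (measurable_ExtL0 _)))
    fun X hX => ?_
  filter_upwards [hp.ae_le f hX, hp.ae_le g hX, zero_le_iff_ae.1 hl, le_iff_ae.1 hl1,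
    ae_one (P := P), ae_sub 1 l, ae_smul_add_smul_weakDual l (1 - l) f g X]
    with ω h1 h2 h3 h4 h5 h6 h7
  rw [h5] at h4
  rw [h7, h6, h5, EReal.coe_add, EReal.coe_mul, EReal.coe_mul]
  exact add_le_add (mul_le_mul_of_nonneg_left h1 (EReal.coe_nonneg.2 h3))
    (mul_le_mul_of_nonneg_left h2 (EReal.coe_nonneg.2 (sub_nonneg.2 h4)))

theorem eq_top (hp : IsSupport (∅ : Set E) p) (f : WeakDual (L0 P) E) :
    ∀ᵐ ω ∂P, p f ω = ⊤ := by
  filter_upwards [hp.ae_le_of_forall (f := f) (g := fun _ => ⊤) measurable_const (by simp)]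
    with ω h
  exact top_le_iff.1 h

theorem maximalInvariantOn [NeZero P] (hp : IsSupport C p) (S : Set (WeakDual (L0 P) E)) :
    MaximalInvariantOn S p := by
  rintro ⟨f, -, hf⟩ g -
  rcases C.eq_empty_or_nonempty with rfl | ⟨X, hX⟩
  · exact hp.eq_top g
  · obtain ⟨ω, h1, h2⟩ := (hf.and (hp.ae_le f hX)).exists
    rw [h1, top_le_iff] at h2
    exact absurd h2 (EReal.coe_ne_top _)

/-- An upper level set is an intersection of closed sets, one for each point of `C`. -/
theorem upperSemicontOn (hp : IsSupport C p) (S : Set (WeakDual (L0 P) E)) :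
    UpperSemicontOn S p := by
  intro m
  have e : {f : S | m ≤ p f} = ⋂ X ∈ C, {f : S | m ≤ toExt (f.1 X)} := by
    ext f
    simp only [Set.mem_iInter]
    exact hp.le_iff
  rw [e]
  refine isClosed_biInter fun X _ => ?_
  exact (isClosed_le_toExt m).preimage ((WeakDual.eval_continuous X).comp continuous_subtype_val)

theorem isPenaltyOn [NeZero P] (hp : IsSupport C p) (S : Set (WeakDual (L0 P) E)) :
    IsPenaltyOn S p :=
  ⟨hp.localOn S, hp.posHomogeneousOn S, hp.l0ConcaveOn S, hp.maximalInvariantOn S,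
    hp.upperSemicontOn S⟩

theorem map_zero (hp : IsSupport C p) (hC : C.Nonempty) : p 0 = toExt 0 := by
  refine (hp 0).unique ?_
  have : (fun X => toExt ((0 : WeakDual (L0 P) E) X)) '' C = {toExt 0} := by
    rw [← hC.image_const]
    rfl
  rw [this]
  exact isGLB_singleton

end IsSupport

end

variable {E : Type*} [AddCommGroup E] [Module (L0 P) E] [TopologicalSpace E]
  [IsTopologicalAddGroup E] [ContinuousSMul (L0 P) E]

theorem IsSupport.represents [IsProbabilityMeasure P] (hE : CondLocallyConvex P E) {K C : Set E}
    (hCclosed : IsClosed C) (hCconvex : L0Convex P C) (hCmono : MonotoneSet K C)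
    (hCstable : SigmaStable P C) {p : WeakDual (L0 P) E → ExtL0 P} (hp : IsSupport C p) :
    Represents (polarCone P K) p C := by
  classical
  intro X
  refine ⟨fun hX f _ => (hp f).1 ⟨X, hX, rfl⟩, fun h => ?_⟩
  by_contra hX
  rcases C.eq_empty_or_nonempty with rfl | hCne
  -- For empty `C`, the zero form already rules out every X.
  · obtain ⟨ω, h1, h2, h3⟩ := ((hp.eq_top 0).and
      ((le_iff_ae.1 (h 0 (zero_mem_polarCone K))).and (ae_toExt _))).exists
    rw [h1, h3, top_le_iff] at h2
    exact EReal.coe_ne_top _ h2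
  · obtain ⟨A, hA, hPA, f, e, he, hf⟩ :=
      exists_weakDual_separation hE hCne hCclosed hCconvex hCstable hX
    have hloc := fun Y => ae_glue_weakDual hA f 0 Y
    have hfK : ind P A hA • f + ind P Aᶜ hA.compl • (0 : WeakDual (L0 P) E) ∈ polarCone P K := by
      rw [mem_polarCone_iff]
      intro k hk
      obtain ⟨c₀, hc₀⟩ := hCne
      -- Moving from c₀ along k stays in `C`, where f is bounded below on A; hence f k ≥ 0 there.
      have hmem : ∀ n : ℕ, c₀ + n • k ∈ C := by
        intro n
        induction n with
        | zero => simpa using hc₀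
        | succ n ih =>
          rw [succ_nsmul, ← add_assoc]
          exact hCmono.add_mem ih hk
      have hval : ∀ n : ℕ, ∀ᵐ ω ∂P, f (c₀ + n • k) ω = f c₀ ω + n * f k ω := by
        intro n
        induction n with
        | zero => simp
        | succ n ih =>
          rw [succ_nsmul, ← add_assoc, map_add]
          filter_upwards [ih, ae_add (f (c₀ + n • k)) (f k)] with ω h1 h2
          rw [h2, h1]; push_cast; ring
      filter_upwards [hloc k, ae_all_iff.2 fun n => hf _ (hmem n), ae_all_iff.2 hval, he,
        ae_zero (P := P)] with ω h1 h2 h3 h4 h5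
      by_cases hω : ω ∈ A
      · rw [h1.1 hω]
        by_contra hneg
        obtain ⟨n, hn⟩ := exists_nat_gt ((f c₀ ω - f X ω) / (-f k ω))
        rw [div_lt_iff₀ (by linarith)] at hn
        have := h2 n hω
        rw [h3] at this
        linarith [h4 hω]
      · rw [h1.2 hω]
        exact h5.ge
    have h1 := hp.ae_le_of_forall
      (f := ind P A hA • f + ind P Aᶜ hA.compl • (0 : WeakDual (L0 P) E))
      (g := A.piecewise (fun ω => ((f X ω + e ω : ℝ) : EReal)) 0)
      (Measurable.piecewise hA ((measurable_L0 _).add (measurable_L0 _)).coe_real_ereal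
        measurable_const) (fun c hc => by
          filter_upwards [hf c hc, hloc c, ae_zero (P := P)] with ω h1 h2 h3
          by_cases hω : ω ∈ A
          · rw [Set.piecewise_eq_of_mem _ _ _ hω, h2.1 hω]
            exact EReal.coe_le_coe_iff.2 (h1 hω)
          · rw [Set.piecewise_eq_of_notMem _ _ _ hω, h2.2 hω]
            exact EReal.coe_nonneg.2 h3.ge)
    refine hPA.ne' (measure_eq_zero_iff_ae_notMem.2 ?_)
    filter_upwards [h1, le_iff_ae.1 (h _ hfK), ae_toExt ((ind P A hA • f +
      ind P Aᶜ hA.compl • (0 : WeakDual (L0 P) E)) X), hloc X, he] with ω h1 h2 h3 h4 h5 hω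
    have h6 := h1.trans h2
    rw [h3, h4.1 hω, Set.piecewise_eq_of_mem _ _ _ hω, EReal.coe_le_coe_iff] at h6
    linarith [h5 hω]

end

section

/-! ### Boxes in finite powers of `L⁰` -/

section Box

variable {J : Type*}

/-- The box with random side lengths. -/
def box (ε : J → L0 P) : Set (J → L0 P) := {u | ∀ j, u j ∈ ball0 (ε j)}

theorem smul_mem_ball0 {ε l a : L0 P} (hl : |l| ≤ 1) (ha : a ∈ ball0 ε) : l * a ∈ ball0 ε := by
  rw [mem_ball0] at *
  filter_upwards [ha, ae_mul l a, le_iff_ae.1 hl, AEEqFun.coeFn_abs l, ae_one (P := P)]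
    with ω h1 h2 h3 h4 h5
  rw [h4, h5] at h3
  rw [h2, abs_mul]
  exact (mul_le_of_le_one_left (abs_nonneg _) h3).trans h1

theorem box_convex (ε : J → L0 P) : L0Convex P (box ε) := by
  intro l hl hl1 u hu v hv j
  have hu' := hu j
  have hv' := hv j
  rw [mem_ball0] at *
  filter_upwards [hu', hv', zero_le_iff_ae.1 hl, le_iff_ae.1 hl1, ae_one (P := P),
    ae_sub 1 l, ae_add (l * u j) ((1 - l) * v j), ae_mul l (u j), ae_mul (1 - l) (v j)]
    with ω h1 h2 h3 h4 h5 h6 h7 h8 h9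
  rw [h5] at h4 h6
  change |(l * u j + (1 - l) * v j : L0 P) ω| ≤ _
  rw [h7, h8, h9, h6]
  have h10 := abs_le.1 h1
  have h11 := abs_le.1 h2
  have h12 : 0 ≤ 1 - l ω := by linarith
  rw [abs_le]
  constructor <;> nlinarith

theorem box_balanced (ε : J → L0 P) : L0Balanced P (box ε) :=
  fun _ hl _ hu j => smul_mem_ball0 hl (hu j)

theorem zero_mem_box {ε : J → L0 P} (hε : ∀ j, StrictPos (ε j)) : 0 ∈ box ε := fun j =>
  mem_of_mem_nhds (nhds_zero_hasBasis_L0.mem_of_mem (hε j))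

theorem box_absorbent [Fintype J] {ε : J → L0 P} (hε : ∀ j, StrictPos (ε j)) :
    L0Absorbent P (box ε) := by
  intro u
  -- One random factor dominating all coordinate ratios; the 1 keeps it strictly positive.
  have hm : Measurable fun ω => 1 + ∑ j, |u j ω| / |ε j ω| :=
    measurable_const.add (Finset.measurable_fun_sum _ fun j _ =>
      ((measurable_L0 (u j)).abs.div (measurable_L0 (ε j)).abs))
  have hpos : StrictPos (ofMeas P _ hm) := by
    filter_upwards [ae_ofMeas (P := P) _ hm] with ω h
    rw [h]; positivity
  obtain ⟨b, hb, hbl⟩ := hpos.exists_inv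
  refine ⟨ofMeas P _ hm, hpos, b • u, fun j => ?_, by
    rw [smul_smul, mul_comm, hbl, one_smul]⟩
  rw [mem_ball0]
  have hbl' : ∀ᵐ ω ∂P, b ω * ofMeas P _ hm ω = 1 := by
    filter_upwards [ae_mul b (ofMeas P _ hm), ae_one (P := P)] with ω h1 h2
    rw [← h1, hbl, h2]
  filter_upwards [ae_ofMeas (P := P) _ hm, hbl', hb, hε j, ae_mul b (u j)] with ω h1 h2 h3 h4 h5
  change |(b * u j : L0 P) ω| ≤ _
  rw [h5, abs_mul, abs_of_pos h3]
  have h6 : |u j ω| / |ε j ω| ≤ ∑ j, |u j ω| / |ε j ω| :=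
    Finset.single_le_sum (f := fun j => |u j ω| / |ε j ω|) (fun i _ => by positivity)
      (Finset.mem_univ j)
  have h7 : |u j ω| ≤ ofMeas P _ hm ω * ε j ω := by
    rw [h1, ← div_le_iff₀ h4]
    rw [abs_of_pos h4] at h6
    linarith
  calc b ω * |u j ω| ≤ b ω * (ofMeas P _ hm ω * ε j ω) := mul_le_mul_of_nonneg_left h7 h3.le
    _ = ε j ω := by rw [← mul_assoc, h2, one_mul]

end Box

/-! ### Uniqueness of the representing function -/

section

variable {E : Type*} [AddCommGroup E] [Module (L0 P) E] [TopologicalSpace E]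

theorem exists_finite_nhds_weakDual {f : WeakDual (L0 P) E} {W : Set (WeakDual (L0 P) E)}
    (hW : W ∈ 𝓝 f) : ∃ (I : Set E) (ε : E → L0 P), I.Finite ∧ (∀ x, StrictPos (ε x)) ∧
      ∀ g : WeakDual (L0 P) E, (∀ x ∈ I, g x - f x ∈ ball0 (ε x)) → g ∈ W := by
  have hind : Topology.IsInducing fun (g : WeakDual (L0 P) E) (x : E) => g x := ⟨rfl⟩
  rw [hind.nhds_eq_comap, mem_comap] at hW
  obtain ⟨T, hT, hTW⟩ := hW
  rw [nhds_pi, Filter.mem_pi] at hT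
  obtain ⟨I, hI, t, ht, hsub⟩ := hT
  have h : ∀ x, ∃ ε : L0 P, StrictPos ε ∧ ∀ a, a - f x ∈ ball0 ε → a ∈ t x := by
    intro x
    have h1 : (fun a : L0 P => a + f x) ⁻¹' t x ∈ 𝓝 (0 : L0 P) := by
      refine (continuous_add_const (f x)).continuousAt.preimage_mem_nhds ?_
      rw [zero_add]
      exact ht x
    obtain ⟨ε, hε, hsub⟩ := nhds_zero_hasBasis_L0.mem_iff.1 h1
    refine ⟨ε, hε, fun a ha => ?_⟩
    have := hsub ha
    rwa [Set.mem_preimage, sub_add_cancel] at this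
  choose ε hε hεt using h
  exact ⟨I, ε, hI, hε, fun g hg => hTW (hsub fun x hx => hεt x _ (hg x hx))⟩

/-- The form f is the gluing of g on A with f itself off A. -/
theorem LocalOn.ae_eq_on {S : Set (WeakDual (L0 P) E)} {q : WeakDual (L0 P) E → ExtL0 P}
    (hq : LocalOn S q) {A : Set Ω} (hA : MeasurableSet A) {f g : WeakDual (L0 P) E} (hf : f ∈ S)
    (hg : g ∈ S) (h : ∀ x, ∀ᵐ ω ∂P, ω ∈ A → f x ω = g x ω) :
    ∀ᵐ ω ∂P, ω ∈ A → q f ω = q g ω := by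
  have e : ind P A hA • g + ind P Aᶜ hA.compl • f = f := by
    refine DFunLike.ext _ _ fun x => AEEqFun.ext ?_
    filter_upwards [ae_glue_weakDual hA g f x, h x] with ω h1 h2
    by_cases hω : ω ∈ A
    · rw [h1.1 hω, h2 hω]
    · rw [h1.2 hω]
  have h1 := hq A hA g hg f hf
  rw [e] at h1
  filter_upwards [h1] with ω h1 hω
  exact h1.1 hω

theorem Represents.le_support {S : Set (WeakDual (L0 P) E)} {p q : WeakDual (L0 P) E → ExtL0 P}
    {C : Set E} (hq : Represents S q C) (hp : IsSupport C p) {f : WeakDual (L0 P) E}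
    (hf : f ∈ S) : q f ≤ p f :=
  hp.le_iff.2 fun X hX => (hq X).1 hX f hf

theorem Represents.ae_le {S : Set (WeakDual (L0 P) E)} {q : WeakDual (L0 P) E → ExtL0 P}
    {C : Set E} (hq : Represents S q C) {f : WeakDual (L0 P) E} (hf : f ∈ S) {X : E}
    (hX : X ∈ C) : ∀ᵐ ω ∂P, q f ω ≤ (f X ω : EReal) := by
  filter_upwards [le_iff_ae.1 ((hq X).1 hX f hf), ae_toExt (f X)] with ω h1 h2
  rwa [h2] at h1

theorem Represents.mem_of_ae_le {S : Set (WeakDual (L0 P) E)} {q : WeakDual (L0 P) E → ExtL0 P}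
    {C : Set E} (hq : Represents S q C) {X : E}
    (h : ∀ f ∈ S, ∀ᵐ ω ∂P, q f ω ≤ (f X ω : EReal)) : X ∈ C := by
  refine (hq X).2 fun f hf => le_iff_ae.2 ?_
  filter_upwards [h f hf, ae_toExt (f X)] with ω h1 h2
  rwa [h2]

/-- A penalty function that is `-∞` at `0` on an event is `-∞` everywhere on that event. -/
theorem ae_eq_bot_of_zero {K : Set E} {q : WeakDual (L0 P) E → ExtL0 P}
    (hhom : PosHomogeneousOn (polarCone P K) q) (husc : UpperSemicontOn (polarCone P K) q)
    {f : WeakDual (L0 P) E} (hf : f ∈ polarCone P K) :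
    ∀ᵐ ω ∂P, q 0 ω = ⊥ → q f ω = ⊥ := by
  classical
  let D : Set Ω := {ω | q f ω = ⊥}ᶜ
  have hD : MeasurableSet D := ((measurable_ExtL0 (q f)) (measurableSet_singleton ⊥)).compl
  have hmeas : Measurable (D.piecewise (fun _ => ((-1 : ℝ) : EReal)) (fun _ => ⊥)) :=
    Measurable.piecewise hD measurable_const measurable_const
  -- The level is -1 where q f > -∞ and -∞ elsewhere. With l = 1/(1 + |q f|), every 0 < t ≤ l
  -- satisfies q(t f) = t q(f) ≥ -1 on the first part; letting t → 0 carries this bound to q 0, as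
  -- the level set is closed.
  let m : ExtL0 P := ofMeasExt P _ hmeas
  have hlm : Measurable fun ω => (1 + |(q f ω).toReal|)⁻¹ :=
    (measurable_const.add (measurable_ExtL0 (q f)).ereal_toReal.abs).inv
  let l : L0 P := ofMeas P _ hlm
  have hl : ∀ᵐ ω ∂P, l ω = (1 + |(q f ω).toReal|)⁻¹ := ae_ofMeas _ hlm
  have hlpos : StrictPos l := by
    filter_upwards [hl] with ω h
    rw [h]; positivity
  let Z : polarCone P K := ⟨0, zero_mem_polarCone K⟩
  have hmem : Z ∈ {g : polarCone P K | m ≤ q g} := by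
    rw [← (husc m).closure_eq, mem_closure_iff_nhds]
    intro W hW
    rw [nhds_subtype_eq_comap, mem_comap] at hW
    obtain ⟨W', hW', hsub⟩ := hW
    have hcont : Continuous fun t : L0 P => t • f :=
      WeakDual.continuous_of_continuous_eval fun x => continuous_id.mul continuous_const
    have h1 : (fun t : L0 P => t • f) ⁻¹' W' ∈ 𝓝 (0 : L0 P) := by
      refine hcont.continuousAt.preimage_mem_nhds ?_
      rw [zero_smul]
      exact hW'
    obtain ⟨ε, hε, hεW⟩ := nhds_zero_hasBasis_L0.mem_iff.1 h1
    have ht : StrictPos (ε ⊓ l) := by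
      filter_upwards [hε, hlpos, AEEqFun.coeFn_inf ε l] with ω h1 h2 h3
      rw [h3]; exact lt_inf_iff.2 ⟨h1, h2⟩
    refine ⟨⟨(ε ⊓ l) • f, smul_mem_polarCone ht.nonneg hf⟩, hsub (hεW ?_), ?_⟩
    · change |ε ⊓ l| ≤ ε
      rw [abs_of_nonneg ht.nonneg]
      exact inf_le_left
    · change m ≤ q ((ε ⊓ l) • f)
      rw [le_iff_ae]
      filter_upwards [hhom _ ht f hf, ht, AEEqFun.coeFn_inf ε l, hl, ae_ofMeasExt (P := P) _ hmeas]
        with ω h1 h2 h3 h4 h5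
      rw [h1]
      change ofMeasExt P _ hmeas ω ≤ _
      rw [h5]
      by_cases hω : ω ∈ D
      · rw [Set.piecewise_eq_of_mem _ _ _ hω]
        have h6 : (ε ⊓ l) ω ≤ (1 + |(q f ω).toReal|)⁻¹ := by
          rw [h3, ← h4]; exact inf_le_right
        generalize (ε ⊓ l) ω = t at *
        have hb : q f ω ≠ ⊥ := hω
        by_cases htop : q f ω = ⊤
        · rw [htop, EReal.coe_mul_top_of_pos h2]
          exact le_top
        · lift q f ω to ℝ using ⟨htop, hb⟩ with a
          rw [EReal.toReal_coe] at h6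
          have h7 : t * (1 + |a|) ≤ 1 := by
            rwa [← le_div_iff₀ (by positivity), one_div]
          rw [← EReal.coe_mul]
          have h8 : (-1 : ℝ) ≤ t * a := by nlinarith [neg_abs_le a]
          exact EReal.coe_le_coe_iff.2 h8
      · rw [Set.piecewise_eq_of_notMem _ _ _ hω]
        exact bot_le
  have hle : m ≤ q 0 := hmem
  filter_upwards [le_iff_ae.1 hle, ae_ofMeasExt (P := P) _ hmeas] with ω h1 h2 h3
  by_contra hω
  change ofMeasExt P _ hmeas ω ≤ _ at h1
  rw [h2, h3, Set.piecewise_eq_of_mem D _ _ hω, le_bot_iff] at h1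
  exact EReal.coe_ne_bot _ h1

/-- Where q 0 = -∞ all constraints are void, so an arbitrary X pasted there into a point of `C`
stays in `C`; this event is therefore null. -/
theorem map_zero_of_nowhereFull {K C : Set E} {q : WeakDual (L0 P) E → ExtL0 P}
    (hq : IsPenaltyOn (polarCone P K) q) (hR : Represents (polarCone P K) q C)
    (hC : C.Nonempty) (hfull : NowhereFull P C) : q 0 = toExt 0 := by
  obtain ⟨c₀, hc₀⟩ := hC
  have hB : MeasurableSet {ω | q 0 ω = ⊥} := (measurable_ExtL0 (q 0)) (measurableSet_singleton ⊥)
  have hPB : P {ω | q 0 ω = ⊥} = 0 := by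
    by_contra hne
    obtain ⟨X, hX⟩ := hfull _ hB (pos_iff_ne_zero.2 hne)
    refine hX (ind P _ hB • X + ind P _ hB.compl • c₀) (hR.mem_of_ae_le fun f hf => ?_) ?_
    · rw [map_add, map_smul, map_smul, smul_eq_mul, smul_eq_mul]
      filter_upwards [ae_eq_bot_of_zero hq.posHomogeneous hq.upperSemicont hf, hR.ae_le hf hc₀,
        ae_add (ind P _ hB * f X) (ind P _ hB.compl * f c₀), ae_mul (ind P _ hB) (f X),
        ae_mul (ind P _ hB.compl) (f c₀), ae_ind (P := P) _ hB, ae_ind (P := P) _ hB.compl]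
        with ω h1 h2 h3 h4 h5 h6 h7
      by_cases hω : q 0 ω = ⊥
      · rw [h1 hω]; exact bot_le
      · rw [h3, h4, h5, h6.2 hω, h7.1 hω]
        simpa using h2
    · rw [smul_add, smul_smul, smul_smul, ind_mul_self, ind_compl _ hB, mul_sub, mul_one, ind_mul_self,
        sub_self, zero_smul, add_zero]
  -- Scaling by 2 gives 2a = a for the value a at 0, which is finite: not +∞ because of c₀, not -∞
  -- by the above.
  have h2 := hq.posHomogeneous _ (strictPos_const (two_pos)) 0 (zero_mem_polarCone K)
  rw [smul_zero] at h2
  apply AEEqFun.ext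
  filter_upwards [h2, ae_ofMeas (P := P) _ measurable_const, measure_eq_zero_iff_ae_notMem.1 hPB,
    hR.ae_le (zero_mem_polarCone K) hc₀, ae_toExt (P := P) 0, ae_zero (P := P)]
    with ω h1 h2 h3 h4 h5 h6
  rw [h5, h6]
  rw [h2] at h1
  have htop : q 0 ω ≠ ⊤ := fun h => by
    rw [h, top_le_iff] at h4
    exact EReal.coe_ne_top _ h4
  have hb : q 0 ω ≠ ⊥ := h3
  lift q 0 ω to ℝ using ⟨htop, hb⟩ with a
  rw [← EReal.coe_mul, EReal.coe_eq_coe_iff] at h1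
  rw [EReal.coe_eq_coe_iff]
  linarith

end

end

/-! ### Separation from the hypograph and the inequality p ≤ q -/

section

variable {E : Type*} [AddCommGroup E] [Module (L0 P) E] [TopologicalSpace E]

/-- Evaluation of a form at the points of `I`, together with a level. -/
def evalLevel (I : Set E) (f : WeakDual (L0 P) E) (r : L0 P) : Option I → L0 P :=
  fun j => j.elim r fun x => f x.1

/-- The image under `evalLevel` of the hypograph of `q`. -/
def hypoImage (I : Set E) (S : Set (WeakDual (L0 P) E)) (q : WeakDual (L0 P) E → ExtL0 P) :
    Set (Option I → L0 P) :=
  {d | ∃ f ∈ S, ∃ r : L0 P, (∀ᵐ ω ∂P, (r ω : EReal) ≤ q f ω) ∧ d = evalLevel I f r}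

theorem hypoImage_convex (I : Set E) {K : Set E} {q : WeakDual (L0 P) E → ExtL0 P}
    (hq : L0ConcaveOn (polarCone P K) q) : L0Convex P (hypoImage I (polarCone P K) q) := by
  rintro l hl hl1 _ ⟨f, hf, r, hr, rfl⟩ _ ⟨g, hg, s, hs, rfl⟩
  refine ⟨l • f + (1 - l) • g, smul_add_smul_mem_polarCone hl (sub_nonneg.2 hl1) hf hg,
    l * r + (1 - l) * s, ?_, ?_⟩
  · filter_upwards [hq l hl hl1 f hf g hg, hr, hs, zero_le_iff_ae.1 hl, le_iff_ae.1 hl1,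
      ae_one (P := P), ae_sub 1 l, ae_add (l * r) ((1 - l) * s), ae_mul l r, ae_mul (1 - l) s]
      with ω h1 h2 h3 h4 h5 h6 h7 h8 h9 h10
    rw [h6] at h5 h7
    refine le_trans ?_ h1
    rw [h8, h9, h10, h7, EReal.coe_add, EReal.coe_mul, EReal.coe_mul]
    exact add_le_add (mul_le_mul_of_nonneg_left h2 (EReal.coe_nonneg.2 h4))
      (mul_le_mul_of_nonneg_left h3 (EReal.coe_nonneg.2 (sub_nonneg.2 h5)))
  · funext j
    cases j <;> rfl

theorem smul_mem_hypoImage (I : Set E) {K : Set E} {q : WeakDual (L0 P) E → ExtL0 P}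
    (hq : PosHomogeneousOn (polarCone P K) q) {l : L0 P} (hl : StrictPos l)
    {d : Option I → L0 P} (hd : d ∈ hypoImage I (polarCone P K) q) :
    l • d ∈ hypoImage I (polarCone P K) q := by
  obtain ⟨f, hf, r, hr, rfl⟩ := hd
  refine ⟨l • f, smul_mem_polarCone hl.nonneg hf, l * r, ?_, ?_⟩
  · filter_upwards [hq l hl f hf, hr, hl, ae_mul l r] with ω h1 h2 h3 h4
    rw [h1, h4, EReal.coe_mul]
    exact mul_le_mul_of_nonneg_left h2 (EReal.coe_nonneg.2 h3.le)
  · funext j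
    cases j <;> rfl

/-- The linear forms on `Option I → L⁰` are evaluations at points of `E` plus multiples of the
level. -/
theorem exists_apply_evalLevel {I : Set E} (hI : I.Finite) (F : (Option I → L0 P) →ₗ[L0 P] L0 P) :
    ∃ (X : E) (ρ : L0 P), ∀ f r, F (evalLevel I f r) = f X - ρ * r := by
  classical
  have := hI.fintype
  refine ⟨∑ x : I, F (Pi.single (some x) 1) • x.1, -F (Pi.single none 1), fun f r => ?_⟩
  have h := LinearMap.pi_apply_eq_sum_univ F (evalLevel I f r)
  rw [Fintype.sum_option] at h
  rw [map_sum]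
  simp only [map_smul, smul_eq_mul] at h ⊢
  have e : ∀ j : Option I, (fun i => if j = i then (1 : L0 P) else 0) = Pi.single j 1 := by
    intro j
    funext i
    simp [Pi.single_apply, eq_comm]
  simp only [e] at h
  rw [h, neg_mul, sub_neg_eq_add, add_comm]
  exact congrArg₂ (· + ·) (Finset.sum_congr rfl fun x _ => mul_comm _ _) (mul_comm _ _)

variable [IsTopologicalAddGroup E] [ContinuousSMul (L0 P) E]

/-- If `q` stays below a level at `f₀`, then on some event of positive probability it stays below
that level on all localizations of a weak neighbourhood of `f₀`. -/
theorem exists_event_lt [IsProbabilityMeasure P] (hE : CondLocallyConvex P E) {K : Set E}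
    {q : WeakDual (L0 P) E → ExtL0 P} (hloc : LocalOn (polarCone P K) q)
    (husc : UpperSemicontOn (polarCone P K) q) {f₀ : WeakDual (L0 P) E}
    (hf₀ : f₀ ∈ polarCone P K) {m : ExtL0 P} (hm : ¬ m ≤ q f₀) :
    ∃ (I : Set E) (ε : E → L0 P) (A : Set Ω), I.Finite ∧ (∀ x, StrictPos (ε x)) ∧
      MeasurableSet A ∧ 0 < P A ∧ ∀ f ∈ polarCone P K, (∀ x ∈ I, f x - f₀ x ∈ ball0 (ε x)) →
        ∀ᵐ ω ∂P, ω ∈ A → q f ω < m ω := by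
  have hW : {f : polarCone P K | m ≤ q f}ᶜ ∈ 𝓝 (⟨f₀, hf₀⟩ : polarCone P K) :=
    (husc m).isOpen_compl.mem_nhds hm
  rw [nhds_subtype_eq_comap, mem_comap] at hW
  obtain ⟨W, hW, hsub⟩ := hW
  obtain ⟨I, ε, hI, hε, hIW⟩ := exists_finite_nhds_weakDual hW
  -- If the events {m ≤ q f}, f in this neighbourhood, covered Ω almost surely, gluing countably
  -- many f would give a member of it with q ≥ m everywhere, which semicontinuity excludes.
  let ι := {f : WeakDual (L0 P) E // f ∈ polarCone P K ∧ ∀ x ∈ I, f x - f₀ x ∈ ball0 (ε x)}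
  have h₀ : ∀ x ∈ I, f₀ x - f₀ x ∈ ball0 (ε x) := fun x _ => by
    rw [sub_self]
    exact mem_of_mem_nhds (nhds_zero_hasBasis_L0.mem_of_mem (hε x))
  let i₀ : ι := ⟨f₀, hf₀, h₀⟩
  have : Nonempty ι := ⟨i₀⟩
  have hG : ∀ i : ι, MeasurableSet {ω | m ω ≤ q i.1 ω} := fun i =>
    measurableSet_le (measurable_ExtL0 _) (measurable_ExtL0 _)
  obtain ⟨s, hs⟩ := exists_seq_ae_cover (P := P) (fun i : ι => {ω | m ω ≤ q i.1 ω}) hG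
  let Q := coverPartition (fun n => {ω | m ω ≤ q (s n).1 ω}) (fun n => hG _)
  refine ⟨I, ε, (⋃ n, {ω | m ω ≤ q (s n).1 ω})ᶜ, hI, hε,
    (MeasurableSet.iUnion fun n => hG _).compl, ?_, fun f hf hfI => ?_⟩
  · by_contra h0
    let t : ℕ → ι := fun n => Nat.casesOn n i₀ s
    obtain ⟨F, hF⟩ := exists_glue_weakDual hE Q (fun n => (t n).1)
    have hFK : F ∈ polarCone P K := by
      rw [mem_polarCone_iff]
      intro X hX
      filter_upwards [ae_all_iff.2 fun i => hF i X,
        ae_all_iff.2 fun i => mem_polarCone_iff.1 (t i).2.1 X hX] with ω h1 h2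
      obtain ⟨i, hi⟩ := Q.exists_mem ω
      rw [h1 i hi]; exact h2 i
    have hFI : ∀ x ∈ I, F x - f₀ x ∈ ball0 (ε x) := by
      intro x hx
      rw [mem_ball0]
      filter_upwards [ae_all_iff.2 fun i => hF i x, ae_sub (F x) (f₀ x),
        ae_all_iff.2 fun i => mem_ball0.1 ((t i).2.2 x hx),
        ae_all_iff.2 fun i => ae_sub ((t i).1 x) (f₀ x)] with ω h1 h2 h3 h4
      obtain ⟨i, hi⟩ := Q.exists_mem ω
      rw [h2, h1 i hi, ← h4]
      exact h3 i
    have hle : m ≤ q F := by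
      rw [le_iff_ae]
      have h1 : ∀ᵐ ω ∂P, ω ∉ (⋃ n, {ω | m ω ≤ q (s n).1 ω})ᶜ :=
        measure_eq_zero_iff_ae_notMem.1 (le_antisymm (not_lt.1 h0) bot_le)
      filter_upwards [h1, ae_all_iff.2 fun i =>
        hloc.ae_eq_on (Q.measurable i) hFK (t i).2.1 (hF i)] with ω h1 h2
      obtain ⟨i, hi⟩ := Q.exists_mem ω
      cases i with
      | zero => exact absurd hi h1
      | succ n =>
        rw [h2 _ hi]
        exact disjointed_subset (fun n => {ω | m ω ≤ q (s n).1 ω}) n hi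
    exact hsub (show (⟨F, hFK⟩ : polarCone P K) ∈ Subtype.val ⁻¹' W from hIW F hFI) hle
  · filter_upwards [hs ⟨f, hf, hfI⟩] with ω h1 hω
    by_contra hlt
    obtain ⟨n, hn⟩ := h1 (not_lt.1 hlt)
    exact hω (Set.mem_iUnion.2 ⟨n, hn⟩)

/-- If `q` stays below a real level `r < s` at `f₀` on an event of positive probability, a point
of `E` separates `(f₀, s)` from the hypograph of `q` on a smaller event. -/
theorem exists_point_separation [IsProbabilityMeasure P] (hE : CondLocallyConvex P E) {K : Set E}
    {q : WeakDual (L0 P) E → ExtL0 P} (hq : IsPenaltyOn (polarCone P K) q)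
    (hq0 : q 0 = toExt 0) {f₀ : WeakDual (L0 P) E} (hf₀ : f₀ ∈ polarCone P K)
    {B : Set Ω} (hB : MeasurableSet B) (hPB : 0 < P B) {r s : ℝ} (hrs : r < s)
    (hr : ∀ ω ∈ B, q f₀ ω < (r : EReal)) :
    ∃ (A : Set Ω) (X : E) (ρ : L0 P), MeasurableSet A ∧ 0 < P A ∧
      (∀ᵐ ω ∂P, ω ∈ A → ω ∈ B ∧ 0 ≤ ρ ω ∧ f₀ X ω < ρ ω * s) ∧
      ∀ f ∈ polarCone P K, ∀ t : L0 P, (∀ᵐ ω ∂P, (t ω : EReal) ≤ q f ω) →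
        ∀ᵐ ω ∂P, ω ∈ A → ρ ω * t ω ≤ f X ω := by
  classical
  -- The level -∞ off B forces the event A found below into B, since nothing is smaller than -∞.
  have hmeas : Measurable (B.piecewise (fun _ => (r : EReal)) (fun _ => ⊥)) :=
    Measurable.piecewise hB measurable_const measurable_const
  let m : ExtL0 P := ofMeasExt P _ hmeas
  have hmv : ∀ᵐ ω ∂P, m ω = B.piecewise (fun _ => (r : EReal)) (fun _ => ⊥) ω :=
    ae_ofMeasExt _ hmeas
  have hm : ¬ m ≤ q f₀ := by
    intro hle
    refine hPB.ne' (measure_eq_zero_iff_ae_notMem.2 ?_)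
    filter_upwards [le_iff_ae.1 hle, hmv] with ω h1 h2 hω
    rw [h2, Set.piecewise_eq_of_mem _ _ _ hω] at h1
    exact absurd (hr ω hω) (not_lt.2 h1)
  obtain ⟨I, ε, A, hI, hε, hA, hPA, hlt⟩ :=
    exists_event_lt hE hq.isLocal hq.upperSemicont hf₀ hm
  have := hI.fintype
  let S : L0 P := ofMeas P (fun _ => s) measurable_const
  have hS : ∀ᵐ ω ∂P, S ω = s := ae_ofMeas _ measurable_const
  -- A level within s - r of s is at least r, which q cannot reach near f₀ on A.
  let δ : L0 P := ofMeas P (fun _ => s - r) measurable_const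
  have hδ : ∀ᵐ ω ∂P, δ ω = s - r := ae_ofMeas _ measurable_const
  let η : Option I → L0 P := fun j => j.elim δ fun x => ε x.1
  have hη : ∀ j, StrictPos (η j) := by
    rintro (_ | x)
    · exact strictPos_const (sub_pos.2 hrs)
    · exact hε x.1
  have h0 : ∀ t : L0 P, t ≤ 0 → evalLevel I 0 t ∈ hypoImage I (polarCone P K) q := by
    intro t ht
    refine ⟨0, zero_mem_polarCone K, t, ?_, rfl⟩
    rw [hq0]
    filter_upwards [le_iff_ae.1 ht, ae_toExt (P := P) 0] with ω h1 h2
    rw [h2]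
    exact EReal.coe_le_coe_iff.2 h1
  obtain ⟨F, -, u, hu, hpos, hF⟩ := exists_linear_separation
    (hypoImage_convex I hq.concave) ⟨_, h0 0 le_rfl⟩ (box_convex η) (box_absorbent hη)
    (box_balanced η) (zero_mem_box hη) (evalLevel I f₀ S) hA (by
      rintro B' hB' hB'A hPB' _ ⟨f, hf, t, ht, rfl⟩ u hu heq
      have hcoord : ∀ j, ∀ᵐ ω ∂P, ω ∈ B' →
          evalLevel I f t j ω - evalLevel I f₀ S j ω = u j ω := by
        intro j
        have := ind_mul_eq_iff (P := P) hB' |>.1 (congrFun heq j)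
        filter_upwards [this, ae_sub (evalLevel I f t j) (evalLevel I f₀ S j)] with ω h1 h2 hω
        rw [← h1 hω, ← h2]
        rfl
      -- The form f is close to f₀ only on B'; replacing it by f₀ elsewhere puts it in the weak
      -- neighbourhood.
      have hgK := glue_mem_polarCone hB' hf hf₀
      have hgI : ∀ x ∈ I, (ind P B' hB' • f + ind P B'ᶜ hB'.compl • f₀) x - f₀ x ∈
          ball0 (ε x) := by
        intro x hx
        rw [mem_ball0]
        filter_upwards [ae_sub ((ind P B' hB' • f + ind P B'ᶜ hB'.compl • f₀) x) (f₀ x),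
          ae_glue_weakDual hB' f f₀ x, hcoord (some ⟨x, hx⟩),
          mem_ball0.1 (hu (some ⟨x, hx⟩)), hε x] with ω h1 h2 h3 h4 h5
        rw [h1]
        by_cases hω : ω ∈ B'
        · rw [h2.1 hω]
          have := h3 hω
          rw [← this] at h4
          exact h4
        · rw [h2.2 hω, sub_self, abs_zero]
          exact h5.le
      refine hPB'.ne' (measure_eq_zero_iff_ae_notMem.2 ?_)
      filter_upwards [hlt _ hgK hgI, hq.isLocal B' hB' f hf f₀ hf₀, ht, hcoord none,
        mem_ball0.1 (hu none), hmv, hS, hδ] with ω h1 h2 h3 h4 h5 h6 h7 h8 hω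
      have h9 := h1 (hB'A hω)
      rw [h2.1 hω] at h9
      have h10 : t ω - S ω = u none ω := h4 hω
      have h11 : |u none ω| ≤ δ ω := h5
      rw [← h10, h7, h8] at h11
      have h12 : (r : EReal) ≤ (t ω : EReal) :=
        EReal.coe_le_coe_iff.2 (by linarith [(abs_le.1 h11).1])
      have h13 : m ω ≤ (r : EReal) := by
        rw [h6]
        by_cases hω : ω ∈ B
        · rw [Set.piecewise_eq_of_mem _ _ _ hω]
        · rw [Set.piecewise_eq_of_notMem _ _ _ hω]; exact bot_le
      exact absurd (h9.trans_le h13) (not_lt.2 (h12.trans h3)))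
  obtain ⟨X, ρ, hX⟩ := exists_apply_evalLevel hI F
  -- F is bounded below on A over a set closed under multiplication by n + 1, so it is nonnegative
  -- there.
  have hnonneg : ∀ d ∈ hypoImage I (polarCone P K) q, ∀ᵐ ω ∂P, ω ∈ A → 0 ≤ F d ω := by
    intro d hd
    have h1 : ∀ n : ℕ, ∀ᵐ ω ∂P, ω ∈ A →
        F (evalLevel I f₀ S) ω + F u ω ≤ ((n : ℝ) + 1) * F d ω := by
      intro n
      have hn : (0 : ℝ) < (n : ℝ) + 1 := by positivity
      have := hF _ (smul_mem_hypoImage I hq.posHomogeneous (strictPos_const hn) hd)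
      rw [map_smul, smul_eq_mul] at this
      filter_upwards [this, ae_mul (ofMeas P (fun _ => (n : ℝ) + 1) measurable_const) (F d),
        ae_ofMeas (P := P) (fun _ => (n : ℝ) + 1) measurable_const] with ω h1 h2 h3 hω
      rw [← h3, ← h2]
      exact h1 hω
    filter_upwards [ae_all_iff.2 h1] with ω h1 hω
    by_contra hneg
    obtain ⟨n, hn⟩ := exists_nat_gt (-(F (evalLevel I f₀ S) ω + F u ω) / (-F d ω))
    rw [div_lt_iff₀ (by linarith)] at hn
    have := h1 n hω
    linarith
  refine ⟨A, X, ρ, hA, hPA, ?_, fun f hf t ht => ?_⟩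
  -- The point (0, -1) of the hypograph gives ρ ≥ 0, and (0, 0) gives the strict inequality at f₀.
  · have h1 := hnonneg _ (h0 (-1) (neg_nonpos.2 one_nonneg_L0))
    have h2 := hF _ (h0 0 le_rfl)
    have e1 : F (evalLevel I 0 (-1)) = ρ := by
      rw [hX]
      change 0 - ρ * -1 = ρ
      ring
    have e2 : F (evalLevel I 0 0) = 0 := by
      rw [hX]
      change 0 - ρ * 0 = 0
      ring
    rw [e1] at h1
    rw [e2, hX] at h2
    filter_upwards [h1, h2, hpos, hlt f₀ hf₀ (fun x _ => by
      rw [sub_self]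
      exact mem_of_mem_nhds (nhds_zero_hasBasis_L0.mem_of_mem (hε x))), hmv, ae_zero (P := P),
      ae_sub (f₀ X) (ρ * S), ae_mul ρ S, hS] with ω h1 h2 h3 h4 h5 h6 h7 h8 h9 hω
    refine ⟨?_, h1 hω, ?_⟩
    · by_contra hωB
      have := h4 hω
      rw [h5, Set.piecewise_eq_of_notMem _ _ _ hωB] at this
      exact not_lt_bot this
    · have := h2 hω
      rw [h6, h7, h8, h9] at this
      linarith [h3 hω]
  · have h1 := hnonneg _ ⟨f, hf, t, ht, rfl⟩
    rw [hX] at h1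
    filter_upwards [h1, ae_sub (f X) (ρ * t), ae_mul ρ t] with ω h1 h2 h3 hω
    have := h1 hω
    rw [h2, h3] at this
    linarith

/-- A representing penalty function with value `0` at `0` dominates the support function. -/
theorem IsSupport.le_of_represents [IsProbabilityMeasure P] (hE : CondLocallyConvex P E)
    {K C : Set E} {p q : WeakDual (L0 P) E → ExtL0 P} (hp : IsSupport C p) (hC : C.Nonempty)
    (hq : IsPenaltyOn (polarCone P K) q) (hR : Represents (polarCone P K) q C)
    (hq0 : q 0 = toExt 0) {f₀ : WeakDual (L0 P) E} (hf₀ : f₀ ∈ polarCone P K) :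
    p f₀ ≤ q f₀ := by
  classical
  obtain ⟨c₀, hc₀⟩ := hC
  by_contra hnle
  let B : ℚ × ℚ → Set Ω := fun a =>
    {ω | q f₀ ω < ((a.1 : ℝ) : EReal)} ∩ {ω | ((a.2 : ℝ) : EReal) < p f₀ ω}
  have hB : ∀ a, MeasurableSet (B a) := fun a =>
    (measurableSet_lt (measurable_ExtL0 _) measurable_const).inter
      (measurableSet_lt measurable_const (measurable_ExtL0 _))
  obtain ⟨a, haa, hPa⟩ : ∃ a : ℚ × ℚ, a.1 < a.2 ∧ 0 < P (B a) := by
    by_contra hcon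
    push Not at hcon
    refine hnle (le_iff_ae.2 ?_)
    have h1 : ∀ a : ℚ × ℚ, ∀ᵐ ω ∂P, a.1 < a.2 → ω ∉ B a := by
      intro a
      by_cases h : a.1 < a.2
      · filter_upwards [measure_eq_zero_iff_ae_notMem.1 (le_antisymm (hcon a h) bot_le)]
          with ω h1 _
        exact h1
      · exact Eventually.of_forall fun ω h' => absurd h' h
    filter_upwards [ae_all_iff.2 h1] with ω h1
    by_contra hlt
    obtain ⟨x, hx1, hx2⟩ := EReal.lt_iff_exists_rat_btwn.1 (not_le.1 hlt)
    obtain ⟨y, hy1, hy2⟩ := EReal.lt_iff_exists_rat_btwn.1 hx2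
    refine h1 (x, y) ?_ ⟨hx1, hy2⟩
    exact_mod_cast EReal.coe_lt_coe_iff.1 hy1
  obtain ⟨A, X, ρ, hA, hPA, hprop, hX⟩ := exists_point_separation hE hq hq0 hf₀ (hB a) hPa
    (r := a.1) (s := a.2) (by exact_mod_cast haa) (fun ω hω => hω.1)
  have hX' : ∀ f ∈ polarCone P K, ∀ᵐ ω ∂P, ω ∈ A → q f ω ≠ ⊥ →
      ρ ω * (q f ω).toReal ≤ f X ω := by
    intro f hf
    have hD : MeasurableSet {ω | q f ω = ⊥} :=
      (measurable_ExtL0 (q f)) (measurableSet_singleton ⊥)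
    -- Real levels below q f exist only where q f > -∞, so f is replaced by 0 on the rest, where q
    -- takes the value 0. Where q f = +∞, `toReal` gives the admissible level 0.
    have hg := glue_mem_polarCone hD (zero_mem_polarCone (P := P) K) hf
    have hl := hq.isLocal _ hD 0 (zero_mem_polarCone K) f hf
    have hmeas : Measurable fun ω => (q (ind P _ hD • 0 + ind P _ hD.compl • f) ω).toReal :=
      (measurable_ExtL0 _).ereal_toReal
    have h1 := hX _ hg (ofMeas P _ hmeas) (by
      filter_upwards [ae_ofMeas (P := P) _ hmeas, hl, ae_toExt (P := P) 0] with ω h1 h2 h3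
      rw [h1]
      refine EReal.coe_toReal_le ?_
      by_cases hω : q f ω = ⊥
      · rw [h2.1 hω, hq0, h3]
        exact EReal.coe_ne_bot _
      · rw [h2.2 hω]
        exact hω)
    filter_upwards [h1, hl, ae_ofMeas (P := P) _ hmeas, ae_glue_weakDual hD 0 f X]
      with ω h1 h2 h3 h4 hω hb
    have := h1 hω
    rwa [h3, h2.2 hb, h4.2 hb] at this
  have hbound : ∀ n : ℕ, ∀ᵐ ω ∂P, ω ∈ A → (a.2 : ℝ) * (1 + n * ρ ω) ≤ f₀ c₀ ω + n * f₀ X ω := by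
    intro n
    have hα : Measurable (A.piecewise (fun ω => (1 + n * ρ ω)⁻¹) (fun _ => 1)) :=
      Measurable.piecewise hA
        (measurable_const.add (measurable_const.mul (measurable_L0 ρ))).inv measurable_const
    have hβ : Measurable (A.piecewise (fun ω => n * (1 + n * ρ ω)⁻¹) (fun _ => 0)) :=
      Measurable.piecewise hA (measurable_const.mul
        (measurable_const.add (measurable_const.mul (measurable_L0 ρ))).inv) measurable_const
    -- On A this is (c₀ + nX)/(1 + nρ), and c₀ elsewhere. The bounds q f ≤ f c₀ and ρ q f ≤ f X
    -- average to q f ≤ f Z.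
    let Z : E := ofMeas P _ hα • c₀ + ofMeas P _ hβ • X
    have hZ : ∀ f : WeakDual (L0 P) E, ∀ᵐ ω ∂P,
        (ω ∈ A → 0 ≤ ρ ω → f Z ω * (1 + n * ρ ω) = f c₀ ω + n * f X ω) ∧
          (ω ∉ A → f Z ω = f c₀ ω) := by
      intro f
      have e : f Z = ofMeas P _ hα * f c₀ + ofMeas P _ hβ * f X := by
        rw [map_add, map_smul, map_smul, smul_eq_mul, smul_eq_mul]
      filter_upwards [ae_ofMeas (P := P) _ hα, ae_ofMeas (P := P) _ hβ,
        ae_add (ofMeas P _ hα * f c₀) (ofMeas P _ hβ * f X), ae_mul (ofMeas P _ hα) (f c₀),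
        ae_mul (ofMeas P _ hβ) (f X)] with ω h1 h2 h3 h4 h5
      rw [e, h3, h4, h5, h1, h2]
      refine ⟨fun hω hρ => ?_, fun hω => ?_⟩
      · rw [Set.piecewise_eq_of_mem _ _ _ hω, Set.piecewise_eq_of_mem _ _ _ hω]
        have : 1 + n * ρ ω ≠ 0 := by positivity
        field_simp
      · rw [Set.piecewise_eq_of_notMem _ _ _ hω, Set.piecewise_eq_of_notMem _ _ _ hω]
        ring
    have hZC : Z ∈ C := by
      refine hR.mem_of_ae_le fun f hf => ?_
      filter_upwards [hZ f, hX' f hf, hprop, hR.ae_le hf hc₀] with ω h1 h2 h3 h4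
      by_cases hω : ω ∈ A
      · by_cases hb : q f ω = ⊥
        · rw [hb]; exact bot_le
        have h5 := h2 hω hb
        have h6 := h1.1 hω (h3 hω).2.1
        have hρ := (h3 hω).2.1
        have htop : q f ω ≠ ⊤ := fun h => by
          rw [h, top_le_iff] at h4
          exact EReal.coe_ne_top _ h4
        lift q f ω to ℝ using ⟨htop, hb⟩ with b
        rw [EReal.toReal_coe] at h5
        rw [EReal.coe_le_coe_iff] at h4 ⊢
        have h7 : 0 < 1 + n * ρ ω := by positivity
        refine le_of_mul_le_mul_right ?_ h7
        rw [h6]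
        have h8 := mul_le_mul_of_nonneg_left h5 (Nat.cast_nonneg (α := ℝ) n)
        linarith
      · rw [h1.2 hω]; exact h4
    filter_upwards [hZ f₀, hprop, hp.ae_le f₀ hZC] with ω h1 h2 h3 hω
    obtain ⟨h4, h5, -⟩ := h2 hω
    rw [← h1.1 hω h5]
    refine mul_le_mul_of_nonneg_right ?_ (by positivity)
    exact (EReal.coe_lt_coe_iff.1 (lt_of_lt_of_le h4.2 h3)).le
  refine hPA.ne' (measure_eq_zero_iff_ae_notMem.2 ?_)
  filter_upwards [ae_all_iff.2 hbound, hprop] with ω h1 h2 hω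
  obtain ⟨-, -, h3⟩ := h2 hω
  -- The bounds say n(ρ s - f₀ X) ≤ f₀ c₀ - s for every n, although ρ s - f₀ X > 0.
  obtain ⟨n, hn⟩ := exists_nat_gt ((f₀ c₀ ω - a.2) / (ρ ω * a.2 - f₀ X ω))
  rw [div_lt_iff₀ (by linarith)] at hn
  have := h1 n hω
  linarith

end

end

end CondModule

open MeasureTheory CondModule in
theorem mainTheorem3 {Ω : Type*} [MeasurableSpace Ω] (P : Measure Ω) [IsProbabilityMeasure P]
    {E : Type*} [AddCommGroup E] [Module (L0 P) E] [TopologicalSpace E]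
    [IsTopologicalAddGroup E] [ContinuousSMul (L0 P) E] (hE : CondLocallyConvex P E)
    (K : Set E) (hKcone : IsL0ConvexCone P K) (hKclosed : IsClosed K)
    (C : Set E) (hCclosed : IsClosed C) (hCconvex : L0Convex P C) (hCmono : MonotoneSet K C)
    (hCstable : SigmaStable P C) :
    ∃ p : WeakDual (L0 P) E → ExtL0 P,
      IsPenaltyOn (polarCone P K) p ∧
      Represents (polarCone P K) p C ∧
      (∀ f ∈ polarCone P K, IsGLB ((fun X => toExt (f X)) '' C) (p f)) ∧
      (C.Nonempty → p 0 = toExt 0) ∧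
      (C.Nonempty → ∀ q : WeakDual (L0 P) E → ExtL0 P,
        IsPenaltyOn (polarCone P K) q → Represents (polarCone P K) q C →
        (q 0 = toExt 0 ∨ NowhereFull P C) → Set.EqOn q p (polarCone P K)) ∧
      (C = ∅ → ∀ q : WeakDual (L0 P) E → ExtL0 P, IsPenaltyOn (polarCone P K) q →
        (∃ f ∈ polarCone P K, ∀ᵐ ω ∂P, q f ω = ⊤) → Set.EqOn q p (polarCone P K)) := by
  choose p hp using fun f : WeakDual (L0 P) E =>
    exists_isGLB_ExtL0 ((fun X => toExt (f X)) '' C)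
  have hp : IsSupport C p := hp
  refine ⟨p, hp.isPenaltyOn _, hp.represents hE hCclosed hCconvex hCmono hCstable,
    fun f _ => hp f, hp.map_zero, fun hC q hq hR h f hf => ?_, ?_⟩
  · have hq0 : q 0 = toExt 0 := h.elim id (map_zero_of_nowhereFull hq hR hC)
    exact le_antisymm (hR.le_support hp hf) (hp.le_of_represents hE hC hq hR hq0 hf)
  · rintro rfl q hq hqtop f hf
    apply AEEqFun.ext
    filter_upwards [hq.maximalInvariant hqtop f hf, hp.eq_top f] with ω h1 h2
    rw [h1, h2]
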